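/- Let $\mathbf{C}$ be an abelian category (locally small). For an abelian category $\mathbf{A}$ and objects $M,N$ of $\mathbf{A}$, let $\mathrm{Ext}^0_{\mathbf{A}}(M,N)=\mathrm{Hom}_{\mathbf{A}}(M,N)$ and, for $n\ge 1$, let $\mathrm{Ext}^n_{\mathbf{A}}(M,N)$ be the Yoneda extension group, whose elements are the exact sequences $0\to N\to X^1\to\cdots\to X^n\to M\to 0$ in $\mathbf{A}$ modulo the equivalence relation under which $\mathcal{X}\sim\mathcal{Y}$ if there are an exact sequence $\mathcal{Z}$ and morphisms of exact sequences $\mathcal{X}\leftarrow\mathcal{Z}\rightarrow\mathcal{Y}$ that are the identity on $N$ and $M$; addition is the Baer sum. Let $\mathrm{Ind}\,\mathbf{C}$ be the ind-completion of $\mathbf{C}$, i.e. the full subcategory of presheaves of sets on $\mathbf{C}$ isomorphic to small filtered colimits of representable presheaves, and let $\mathrm{Pro}\,\mathbf{C}=(\mathrm{Ind}(\mathbf{C}^{\mathrm{op}}))^{\mathrm{op}}$ be the pro-completion. Both are abelian, and $\mathbf{C}$ embeds in both by a fully faithful exact functor. (1) $\mathbf{C}$ is extension full in $\mathrm{Ind}\,\mathbf{C}$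 and in $\mathrm{Pro}\,\mathbf{C}$: for all $M,N\in\mathbf{C}$ and all $n\in\mathbb{N}$, the homomorphisms $$\mathrm{Ext}^n_{\mathbf{C}}(M,N)\to\mathrm{Ext}^n_{\mathrm{Ind}\,\mathbf{C}}(M,N)\qquad\text{and}\qquad \mathrm{Ext}^n_{\mathbf{C}}(M,N)\to\mathrm{Ext}^n_{\mathrm{Pro}\,\mathbf{C}}(M,N)$$ induced by the embeddings are bijective. (2) For every functor $F:\mathbf{I}\to\mathbf{C}$ from a small filtered category $\mathbf{I}$, every $Z\in\mathbf{C}$ and every $n\in\mathbb{N}$, the canonical homomorphism $$\mathrm{colim}_{i\in\mathbf{I}}\,\mathrm{Ext}^n_{\mathbf{C}}(Z,F(i))\to\mathrm{Ext}^n_{\mathrm{Ind}\,\mathbf{C}}(Z,\mathrm{colim}\,F)$$ is an isomorphism, where $\mathrm{colim}\,F$ is the colimit of $F$ in $\mathrm{Ind}\,\mathbf{C}$. -/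

import Mathlib

open CategoryTheory CategoryTheory.Limits CategoryTheory.Functor
open scoped ZeroObject
universe v v' u u'

namespace YonedaExt

section Sequences

variable {C : Type u} [Category.{v} C] [Abelian C]

/-- A short exact sequence `0 ⟶ N ⟶ E ⟶ M ⟶ 0`. -/
structure ShortExt (M N : C) : Type (max u v) where
  E : C
  i : N ⟶ E
  p : E ⟶ M
  zero : i ≫ p = 0
  exact : (ShortComplex.mk i p zero).ShortExact

lemma ShortExt.zero_assoc {M N A : C} (X : ShortExt M N) (g : M ⟶ A) : X.i ≫ X.p ≫ g = 0 ≫ g := by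
  rw [← Category.assoc, X.zero]

@[simp]
lemma biprod_map_id (A B : C) : biprod.map (𝟙 A) (𝟙 B) = 𝟙 (A ⊞ B) := by ext <;> simp

namespace ShortExt

attribute [local simp] pullback.lift_fst pullback.lift_snd pullback.lift_fst_assoc
  pullback.lift_snd_assoc pushout.inl_desc pushout.inr_desc pushout.inl_desc_assoc
  pushout.inr_desc_assoc

/-- There is a morphism of short exact sequences with outer components `f` and `g`. -/
def HasMap {M N M' N' : C} (f : N ⟶ N') (g : M ⟶ M') (X : ShortExt M N) (Y : ShortExt M' N') :
    Prop :=
  ∃ e : X.E ⟶ Y.E, X.i ≫ e = f ≫ Y.i ∧ e ≫ Y.p = X.p ≫ g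

lemma shortExact_of_lift {N E M : C} (i : N ⟶ E) (p : E ⟶ M) (zero : i ≫ p = 0) [Mono i] [Epi p]
    (lift : ∀ {A : C} (k : A ⟶ E), k ≫ p = 0 → ∃ l : A ⟶ N, l ≫ i = k) :
    (ShortComplex.mk i p zero).ShortExact where
  exact := by
    refine (ShortComplex.mk i p zero).exact_of_f_is_kernel
      (KernelFork.IsLimit.ofι' _ _ fun k hk => ⟨(lift k hk).choose, (lift k hk).choose_spec⟩)

lemma shortExact_of_desc {N E M : C} (i : N ⟶ E) (p : E ⟶ M) (zero : i ≫ p = 0) [Mono i] [Epi p]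
    (desc : ∀ {A : C} (k : E ⟶ A), i ≫ k = 0 → ∃ l : M ⟶ A, p ≫ l = k) :
    (ShortComplex.mk i p zero).ShortExact where
  exact := by
    refine (ShortComplex.mk i p zero).exact_of_g_is_cokernel
      (CokernelCofork.IsColimit.ofπ' _ _ fun k hk => ⟨(desc k hk).choose, (desc k hk).choose_spec⟩)

variable {M N M' N' M'' N'' : C}

instance (X : ShortExt M N) : Mono X.i := X.exact.mono_f
instance (X : ShortExt M N) : Epi X.p := X.exact.epi_g

lemma exists_lift (X : ShortExt M N) {A : C} (k : A ⟶ X.E) (hk : k ≫ X.p = 0) :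
    ∃ l : A ⟶ N, l ≫ X.i = k :=
  ⟨X.exact.exact.lift k hk, X.exact.exact.lift_f k hk⟩

lemma exists_desc (X : ShortExt M N) {A : C} (k : X.E ⟶ A) (hk : X.i ≫ k = 0) :
    ∃ l : M ⟶ A, X.p ≫ l = k :=
  ⟨X.exact.exact.desc k hk, X.exact.exact.g_desc k hk⟩

/-- The pushout of a short exact sequence along `f : N ⟶ N'`. -/
noncomputable def push (f : N ⟶ N') (X : ShortExt M N) : ShortExt M N' where
  E := pushout X.i f
  i := pushout.inr X.i f
  p := pushout.desc X.p 0 (by simp [X.zero])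
  zero := by simp
  exact := by
    have : Epi (pushout.desc X.p (0 : N' ⟶ M) (by simp [X.zero]) : pushout X.i f ⟶ M) :=
      epi_of_epi_fac (pushout.inl_desc X.p 0 (by simp [X.zero]))
    refine shortExact_of_desc _ _ _ fun k hk => ?_
    obtain ⟨l, hl⟩ := X.exists_desc (pushout.inl X.i f ≫ k) (by
      rw [pushout.condition_assoc, hk, comp_zero])
    exact ⟨l, by ext <;> simp [hl, hk]⟩

/-- The pullback of a short exact sequence along `g : M' ⟶ M`. -/
noncomputable def pull (g : M' ⟶ M) (X : ShortExt M N) : ShortExt M' N where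
  E := pullback X.p g
  i := pullback.lift X.i 0 (by simp [X.zero])
  p := pullback.snd X.p g
  zero := by simp
  exact := by
    have : Mono (pullback.lift X.i (0 : N ⟶ M') (by simp [X.zero]) : N ⟶ pullback X.p g) :=
      mono_of_mono_fac (pullback.lift_fst X.i 0 (by simp [X.zero]))
    refine shortExact_of_lift _ _ _ fun k hk => ?_
    obtain ⟨l, hl⟩ := X.exists_lift (k ≫ pullback.fst X.p g) (by
      rw [Category.assoc, pullback.condition, reassoc_of% hk, zero_comp])
    exact ⟨l, by ext <;> simp [hl, hk]⟩

/-- The direct sum of two short exact sequences. -/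
noncomputable def sum (X : ShortExt M N) (Y : ShortExt M' N') : ShortExt (M ⊞ M') (N ⊞ N') where
  E := X.E ⊞ Y.E
  i := biprod.map X.i Y.i
  p := biprod.map X.p Y.p
  zero := by ext <;> simp [X.zero, Y.zero]
  exact := by
    refine shortExact_of_lift _ _ _ fun k hk => ?_
    obtain ⟨l, hl⟩ := X.exists_lift (k ≫ biprod.fst) (by
      simpa using congr($hk ≫ biprod.fst))
    obtain ⟨l', hl'⟩ := Y.exists_lift (k ≫ biprod.snd) (by
      simpa using congr($hk ≫ biprod.snd))
    exact ⟨biprod.lift l l', by ext <;> simp [hl, hl']⟩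

/-- The split short exact sequence. -/
noncomputable def split (M N : C) : ShortExt M N where
  E := N ⊞ M
  i := biprod.inl
  p := biprod.snd
  zero := by simp
  exact := shortExact_of_lift _ _ _ fun k hk =>
    ⟨k ≫ biprod.fst, by ext <;> simp [hk]⟩

/-- The short exact sequence `0 ⟶ 0 ⟶ M = M ⟶ 0`. -/
noncomputable def idSeq (M : C) : ShortExt M (0 : C) where
  E := M
  i := 0
  p := 𝟙 M
  zero := by simp
  exact := by
    have : Mono (0 : (0 : C) ⟶ M) := ⟨fun _ _ _ => by ext⟩
    exact shortExact_of_lift _ _ _ fun k hk => ⟨0, by simpa using hk.symm⟩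

lemma HasMap.refl (X : ShortExt M N) : X.HasMap (𝟙 N) (𝟙 M) X := ⟨𝟙 _, by simp, by simp⟩

lemma HasMap.comp {f : N ⟶ N'} {g : M ⟶ M'} {f' : N' ⟶ N''} {g' : M' ⟶ M''}
    {X : ShortExt M N} {Y : ShortExt M' N'} {Z : ShortExt M'' N''}
    (h : X.HasMap f g Y) (h' : Y.HasMap f' g' Z) : X.HasMap (f ≫ f') (g ≫ g') Z := by
  obtain ⟨e, h₁, h₂⟩ := h
  obtain ⟨e', h₁', h₂'⟩ := h'
  exact ⟨e ≫ e', by simp [reassoc_of% h₁, h₁'], by simp [h₂', reassoc_of% h₂]⟩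

lemma hasMap_push (f : N ⟶ N') (X : ShortExt M N) : X.HasMap f (𝟙 M) (X.push f) :=
  ⟨pushout.inl _ _, pushout.condition, by simp [push]⟩

lemma hasMap_pull (g : M' ⟶ M) (X : ShortExt M N) : (X.pull g).HasMap (𝟙 N) g X :=
  ⟨pullback.fst _ _, by simp [pull], pullback.condition⟩

lemma HasMap.push_pull {f : N ⟶ N'} {g : M ⟶ M'} {X : ShortExt M N} {Y : ShortExt M' N'}
    (h : X.HasMap f g Y) : (X.push f).HasMap (𝟙 N') (𝟙 M) (Y.pull g) := by
  obtain ⟨e, h₁, h₂⟩ := h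
  have w : (pushout.desc e Y.i h₁ : pushout X.i f ⟶ Y.E) ≫ Y.p =
      pushout.desc X.p 0 (by simp [X.zero]) ≫ g := by
    apply pushout.hom_ext <;> simp [h₂, Y.zero]
  let t : pushout X.i f ⟶ pullback Y.p g :=
    pullback.lift (pushout.desc e Y.i h₁) (pushout.desc X.p 0 (by simp [X.zero])) w
  have h₃ : pushout.inr X.i f ≫ t = pullback.lift Y.i 0 (by simp [Y.zero]) := by
    apply pullback.hom_ext <;> simp [t]
  have h₄ : t ≫ pullback.snd Y.p g = pushout.desc X.p 0 (by simp [X.zero]) := by simp [t]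
  exact ⟨t, h₃.trans (Category.id_comp _).symm, h₄.trans (Category.comp_id _).symm⟩

lemma HasMap.push_left {f : N ⟶ N'} {g : M ⟶ M'} {X : ShortExt M N} {Y : ShortExt M' N'}
    (h : X.HasMap f g Y) : (X.push f).HasMap (𝟙 N') g Y := by
  simpa using h.push_pull.comp (Y.hasMap_pull g)

lemma HasMap.pull_right {f : N ⟶ N'} {g : M ⟶ M'} {X : ShortExt M N} {Y : ShortExt M' N'}
    (h : X.HasMap f g Y) : X.HasMap f (𝟙 M) (Y.pull g) := by
  simpa using (X.hasMap_push f).comp h.push_pull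

lemma HasMap.sum {A B A' B' : C} {f : N ⟶ N'} {g : M ⟶ M'} {f' : B ⟶ B'} {g' : A ⟶ A'}
    {X : ShortExt M N} {Y : ShortExt M' N'} {Z : ShortExt A B} {W : ShortExt A' B'}
    (h : X.HasMap f g Y) (h' : Z.HasMap f' g' W) :
    (X.sum Z).HasMap (biprod.map f f') (biprod.map g g') (Y.sum W) := by
  obtain ⟨e, h₁, h₂⟩ := h
  obtain ⟨e', h₁', h₂'⟩ := h'
  refine ⟨biprod.map e e', ?_, ?_⟩ <;> dsimp only [ShortExt.sum] <;>
    apply biprod.hom_ext <;> apply biprod.hom_ext' <;>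
    simp [h₁, h₁', h₂, h₂']

lemma hasMap_diag (X : ShortExt M N) :
    X.HasMap (biprod.lift (𝟙 N) (𝟙 N)) (biprod.lift (𝟙 M) (𝟙 M)) (X.sum X) :=
  ⟨biprod.lift (𝟙 _) (𝟙 _), by dsimp only [sum]; ext <;> simp, by dsimp only [sum]; ext <;> simp⟩

lemma hasMap_swap (X : ShortExt M N) (Y : ShortExt M' N') :
    (X.sum Y).HasMap (biprod.braiding N N').hom (biprod.braiding M M').hom (Y.sum X) :=
  ⟨(biprod.braiding _ _).hom, by dsimp only [sum]; ext <;> simp, by dsimp only [sum]; ext <;> simp⟩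

lemma hasMap_assoc (X : ShortExt M N) (Y : ShortExt M' N') (Z : ShortExt M'' N'') :
    ((X.sum Y).sum Z).HasMap (biprod.associator N N' N'').hom (biprod.associator M M' M'').hom
      (X.sum (Y.sum Z)) :=
  ⟨(biprod.associator _ _ _).hom, by dsimp only [sum]; ext <;> simp, by dsimp only [sum]; ext <;> simp⟩

lemma hasMap_split (X : ShortExt M N) (N' : C) (g : M ⟶ M') :
    X.HasMap (0 : N ⟶ N') g (split M' N') :=
  ⟨X.p ≫ g ≫ biprod.inr, by simp [X.zero_assoc], by simp [split]⟩

lemma hasMap_idSeq (X : ShortExt M N) (g : M ⟶ M') :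
    X.HasMap (0 : N ⟶ 0) g (idSeq M') :=
  have h : X.i ≫ X.p ≫ g = (0 : N ⟶ 0) ≫ (0 : (0 : C) ⟶ M') := by
    rw [X.zero_assoc, zero_comp, zero_comp]
  ⟨X.p ≫ g, h, Category.comp_id _⟩

lemma map_biprod_comparison {D : Type u'} [Category.{v'} D] [Abelian D] (F : C ⥤ D) 
    {A B A' B' : C} (a : A ⟶ A') (b : B ⟶ B') :
    F.map (biprod.map a b) ≫ biprod.lift (F.map biprod.fst) (F.map biprod.snd) =
      biprod.lift (F.map biprod.fst) (F.map biprod.snd) ≫ biprod.map (F.map a) (F.map b) := by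
  apply biprod.hom_ext
  · rw [Category.assoc, Category.assoc, biprod.lift_fst, biprod.map_fst, biprod.lift_fst_assoc,
      ← F.map_comp, ← F.map_comp, biprod.map_fst]
  · rw [Category.assoc, Category.assoc, biprod.lift_snd, biprod.map_snd, biprod.lift_snd_assoc,
      ← F.map_comp, ← F.map_comp, biprod.map_snd]

variable {D : Type u'} [Category.{v'} D] [Abelian D]
  (F : C ⥤ D) [F.Additive] [PreservesFiniteLimits F] [PreservesFiniteColimits F]

/-- The image of a short exact sequence under an exact functor. -/
def map (X : ShortExt M N) : ShortExt (F.obj M) (F.obj N) where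
  E := F.obj X.E
  i := F.map X.i
  p := F.map X.p
  zero := by rw [← F.map_comp, X.zero, F.map_zero]
  exact := X.exact.map_of_exact F

lemma HasMap.map {f : N ⟶ N'} {g : M ⟶ M'} {X : ShortExt M N} {Y : ShortExt M' N'}
    (h : X.HasMap f g Y) : (X.map F).HasMap (F.map f) (F.map g) (Y.map F) := by
  obtain ⟨e, h₁, h₂⟩ := h
  exact ⟨F.map e, by dsimp only [ShortExt.map]; rw [← F.map_comp, h₁, F.map_comp],
    by dsimp only [ShortExt.map]; rw [← F.map_comp, h₂, F.map_comp]⟩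

lemma hasMap_map_sum (X : ShortExt M N) (Y : ShortExt M' N') :
    ((X.sum Y).map F).HasMap (biprod.lift (F.map biprod.fst) (F.map biprod.snd))
      (biprod.lift (F.map biprod.fst) (F.map biprod.snd)) ((X.map F).sum (Y.map F)) :=
  ⟨biprod.lift (F.map biprod.fst) (F.map biprod.snd), map_biprod_comparison F X.i Y.i,
    (map_biprod_comparison F X.p Y.p).symm⟩

end ShortExt

/-- An exact sequence `0 ⟶ N ⟶ X¹ ⟶ X² ⟶ ⋯ ⟶ Xᵈ⁺¹ ⟶ M ⟶ 0`, recorded together with the kernels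
`K` of its maps, that is, as a splice of `d + 1` short exact sequences: an exact sequence
`0 ⟶ N ⟶ X¹ ⟶ ⋯ ⟶ Xᵈ⁺¹ ⟶ Xᵈ⁺² ⟶ M ⟶ 0` is the same as an exact sequence
`0 ⟶ N ⟶ X¹ ⟶ ⋯ ⟶ Xᵈ⁺¹ ⟶ K ⟶ 0` and a short exact sequence `0 ⟶ K ⟶ Xᵈ⁺² ⟶ M ⟶ 0`. -/
inductive LongExt (N : C) : ℕ → C → Type (max u v)
  | single {M : C} (E : ShortExt M N) : LongExt N 0 M
  | splice {d : ℕ} {K M : C} (X : LongExt N d K) (E : ShortExt M K) : LongExt N (d + 1) M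

namespace LongExt

/-- There is a morphism of exact sequences with components `f : N ⟶ N'` and `g : M ⟶ M'` at the
two ends. -/
def HasMap {N N' : C} (f : N ⟶ N') :
    ∀ {d : ℕ} {M M' : C} (_ : M ⟶ M') (_ : LongExt N d M) (_ : LongExt N' d M'), Prop
  | _, _, _, g, single E, single E' => E.HasMap f g E'
  | _, _, _, g, splice (K := K) X E, splice (K := K') X' E' =>
    ∃ k : K ⟶ K', HasMap f k X X' ∧ E.HasMap k g E'

variable {N N' N'' : C}

/-- The pushout of an exact sequence along `f : N ⟶ N'`. -/
noncomputable def push (f : N ⟶ N') : ∀ {d : ℕ} {M : C}, LongExt N d M → LongExt N' d M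
  | _, _, single E => single (E.push f)
  | _, _, splice X E => splice (push f X) E

/-- The pullback of an exact sequence along `g : M' ⟶ M`. -/
noncomputable def pull {M M' : C} (g : M' ⟶ M) : ∀ {d : ℕ}, LongExt N d M → LongExt N d M'
  | _, single E => single (E.pull g)
  | _, splice X E => splice X (E.pull g)

/-- The direct sum of two exact sequences. -/
noncomputable def sum :
    ∀ {d : ℕ} {M M' : C}, LongExt N d M → LongExt N' d M' → LongExt (N ⊞ N') d (M ⊞ M')
  | _, _, _, single E, single E' => single (E.sum E')
  | _, _, _, splice X E, splice X' E' => splice (sum X X') (E.sum E')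

variable (N) in
/-- The trivial exact sequence: `0 ⟶ N ⟶ N ⊞ M ⟶ M ⟶ 0`, or `0 ⟶ N = N ⟶ 0 ⟶ ⋯ ⟶ 0 ⟶ M = M ⟶ 0`
(with the objects `N`, `M` up to adding a zero object). -/
noncomputable def trivial : ∀ (d : ℕ) (M : C), LongExt N d M
  | 0, M => single (ShortExt.split M N)
  | d + 1, M => splice (trivial d 0) (ShortExt.idSeq M)

lemma HasMap.refl : ∀ {d : ℕ} {M : C} (X : LongExt N d M), HasMap (𝟙 N) (𝟙 M) X X
  | _, _, single E => ShortExt.HasMap.refl E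
  | _, _, splice X E => ⟨𝟙 _, HasMap.refl X, ShortExt.HasMap.refl E⟩

lemma HasMap.comp {f : N ⟶ N'} {f' : N' ⟶ N''} : ∀ {d : ℕ} {M M' M'' : C}
    {g : M ⟶ M'} {g' : M' ⟶ M''} {X : LongExt N d M} {Y : LongExt N' d M'} {Z : LongExt N'' d M''},
    HasMap f g X Y → HasMap f' g' Y Z → HasMap (f ≫ f') (g ≫ g') X Z
  | _, _, _, _, _, _, single _, single _, single _, h, h' => ShortExt.HasMap.comp h h'
  | _, _, _, _, _, _, splice _ _, splice _ _, splice _ _, h, h' => by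
    obtain ⟨k, h₁, h₂⟩ := h
    obtain ⟨k', h₁', h₂'⟩ := h'
    exact ⟨k ≫ k', HasMap.comp h₁ h₁', h₂.comp h₂'⟩

lemma hasMap_push (f : N ⟶ N') :
    ∀ {d : ℕ} {M : C} (X : LongExt N d M), HasMap f (𝟙 M) X (X.push f)
  | _, _, single E => E.hasMap_push f
  | _, _, splice X E => ⟨𝟙 _, hasMap_push f X, ShortExt.HasMap.refl E⟩

lemma hasMap_pull {M M' : C} (g : M' ⟶ M) :
    ∀ {d : ℕ} (X : LongExt N d M), HasMap (𝟙 N) g (X.pull g) X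
  | _, single E => E.hasMap_pull g
  | _, splice X E => ⟨𝟙 _, HasMap.refl X, E.hasMap_pull g⟩

lemma HasMap.push_left {f : N ⟶ N'} : ∀ {d : ℕ} {M M' : C} {g : M ⟶ M'} {X : LongExt N d M}
    {Y : LongExt N' d M'}, HasMap f g X Y → HasMap (𝟙 N') g (X.push f) Y
  | _, _, _, _, single _, single _, h => ShortExt.HasMap.push_left h
  | _, _, _, _, splice _ _, splice _ _, h => by
    obtain ⟨k, h₁, h₂⟩ := h
    exact ⟨k, HasMap.push_left h₁, h₂⟩

lemma HasMap.sum {A B : C} {f : N ⟶ N'} {f' : A ⟶ B} : ∀ {d : ℕ} {M M' P P' : C}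
    {g : M ⟶ M'} {g' : P ⟶ P'} {X : LongExt N d M} {Y : LongExt N' d M'}
    {Z : LongExt A d P} {W : LongExt B d P'}, HasMap f g X Y → HasMap f' g' Z W →
    HasMap (biprod.map f f') (biprod.map g g') (X.sum Z) (Y.sum W)
  | _, _, _, _, _, _, _, single _, single _, single _, single _, h, h' => ShortExt.HasMap.sum h h'
  | _, _, _, _, _, _, _, splice _ _, splice _ _, splice _ _, splice _ _, h, h' => by
    obtain ⟨k, h₁, h₂⟩ := h
    obtain ⟨k', h₁', h₂'⟩ := h'
    exact ⟨biprod.map k k', HasMap.sum h₁ h₁', h₂.sum h₂'⟩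

lemma hasMap_diag : ∀ {d : ℕ} {M : C} (X : LongExt N d M),
    HasMap (biprod.lift (𝟙 N) (𝟙 N)) (biprod.lift (𝟙 M) (𝟙 M)) X (X.sum X)
  | _, _, single E => E.hasMap_diag
  | _, _, splice X E => ⟨_, hasMap_diag X, E.hasMap_diag⟩

lemma hasMap_swap : ∀ {d : ℕ} {M M' : C} (X : LongExt N d M) (Y : LongExt N' d M'),
    HasMap (biprod.braiding N N').hom (biprod.braiding M M').hom (X.sum Y) (Y.sum X)
  | _, _, _, single E, single E' => E.hasMap_swap E'
  | _, _, _, splice X E, splice X' E' => ⟨_, hasMap_swap X X', E.hasMap_swap E'⟩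

lemma hasMap_assoc : ∀ {d : ℕ} {M M' M'' : C} (X : LongExt N d M) (Y : LongExt N' d M')
    (Z : LongExt N'' d M''),
    HasMap (biprod.associator N N' N'').hom (biprod.associator M M' M'').hom
      ((X.sum Y).sum Z) (X.sum (Y.sum Z))
  | _, _, _, _, single E, single E', single E'' => E.hasMap_assoc E' E''
  | _, _, _, _, splice X E, splice X' E', splice X'' E'' =>
    ⟨_, hasMap_assoc X X' X'', E.hasMap_assoc E' E''⟩

lemma hasMap_trivial (N' : C) : ∀ {d : ℕ} {M M' : C} (g : M ⟶ M') (X : LongExt N d M),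
    HasMap (0 : N ⟶ N') g X (trivial N' d M')
  | _, _, _, g, single E => E.hasMap_split N' g
  | _, _, _, g, splice X E => ⟨0, hasMap_trivial N' 0 X, E.hasMap_idSeq g⟩

variable {D : Type u'} [Category.{v'} D] [Abelian D]
  (F : C ⥤ D) [F.Additive] [PreservesFiniteLimits F] [PreservesFiniteColimits F]

/-- The image of an exact sequence under an exact functor. -/
def map : ∀ {d : ℕ} {M : C}, LongExt N d M → LongExt (F.obj N) d (F.obj M)
  | _, _, single E => single (E.map F)
  | _, _, splice X E => splice (map X) (E.map F)

lemma HasMap.map {f : N ⟶ N'} : ∀ {d : ℕ} {M M' : C} {g : M ⟶ M'} {X : LongExt N d M}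
    {Y : LongExt N' d M'}, HasMap f g X Y → HasMap (F.map f) (F.map g) (X.map F) (Y.map F)
  | _, _, _, _, single _, single _, h => ShortExt.HasMap.map F h
  | _, _, _, _, splice _ _, splice _ _, h => by
    obtain ⟨k, h₁, h₂⟩ := h
    exact ⟨F.map k, HasMap.map h₁, h₂.map F⟩

lemma hasMap_map_sum : ∀ {d : ℕ} {M M' : C} (X : LongExt N d M) (Y : LongExt N' d M'),
    HasMap (biprod.lift (F.map biprod.fst) (F.map biprod.snd))
      (biprod.lift (F.map biprod.fst) (F.map biprod.snd))
      ((X.sum Y).map F) ((X.map F).sum (Y.map F))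
  | _, _, _, single E, single E' => E.hasMap_map_sum F E'
  | _, _, _, splice X E, splice X' E' => ⟨_, hasMap_map_sum X X', E.hasMap_map_sum F E'⟩

end LongExt

/-- The equivalence relation on exact sequences `0 ⟶ N ⟶ X¹ ⟶ ⋯ ⟶ Xᵈ⁺¹ ⟶ M ⟶ 0`: the sequences
`X` and `Y` are equivalent if there are a sequence `Z` and morphisms `X ⟵ Z ⟶ Y` of exact sequences
which are the identity on `N` and `M`. -/
def Rel {N M : C} {d : ℕ} (X Y : LongExt N d M) : Prop :=
  ∃ Z : LongExt N d M, LongExt.HasMap (𝟙 N) (𝟙 M) Z X ∧ LongExt.HasMap (𝟙 N) (𝟙 M) Z Y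

/-- Equivalence classes of exact sequences `0 ⟶ N ⟶ X¹ ⟶ ⋯ ⟶ Xᵈ⁺¹ ⟶ M ⟶ 0`. -/
def ExtClass (M N : C) (d : ℕ) : Type (max u v) := Quot (Rel (N := N) (M := M) (d := d))

namespace ExtClass

open LongExt

variable {M M' M'' N N' N'' : C} {d : ℕ}

/-- The class of an exact sequence. -/
def mk (X : LongExt N d M) : ExtClass M N d := Quot.mk _ X

lemma sound {X Y : LongExt N d M} (h : HasMap (𝟙 N) (𝟙 M) X Y) : mk X = mk Y :=
  Quot.sound ⟨X, HasMap.refl X, h⟩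

lemma sound' {X Y : LongExt N d M} (h : Rel X Y) : mk X = mk Y := Quot.sound h

@[elab_as_elim]
lemma ind {p : ExtClass M N d → Prop} (h : ∀ X, p (mk X)) (x : ExtClass M N d) : p x :=
  Quot.ind h x

/-- Functoriality in the variable `N`. -/
noncomputable def push (f : N ⟶ N') : ExtClass M N d → ExtClass M N' d :=
  Quot.map (LongExt.push f) (by
    rintro X Y ⟨Z, hX, hY⟩
    refine ⟨Z.push f, ?_, ?_⟩
    · exact HasMap.push_left (by simpa using HasMap.comp hX (hasMap_push f X))
    · exact HasMap.push_left (by simpa using HasMap.comp hY (hasMap_push f Y)))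

lemma mk_splice_congr {K : C} {X Y : LongExt N d K} (h : mk X = mk Y) (E : ShortExt M K) :
    mk (splice X E) = mk (splice Y E) := by
  have := congrArg (Quot.lift (fun X : LongExt N d K => mk (splice X E)) (by
    rintro X Y ⟨Z, hX, hY⟩
    exact sound' ⟨splice Z E, ⟨𝟙 _, hX, ShortExt.HasMap.refl E⟩, ⟨𝟙 _, hY, ShortExt.HasMap.refl E⟩⟩)) h
  exact this

lemma mk_push_eq_mk_pull {f : N ⟶ N'} : ∀ {d : ℕ} {M M' : C} {g : M ⟶ M'} {X : LongExt N d M}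
    {Y : LongExt N' d M'}, HasMap f g X Y → mk (X.push f) = mk (Y.pull g)
  | _, _, _, _, single _, single _, h => sound (ShortExt.HasMap.push_pull h)
  | _, _, _, g, splice X E, splice Y E', h => by
    obtain ⟨k, h₁, h₂⟩ := h
    exact (mk_splice_congr (mk_push_eq_mk_pull h₁) E).trans
      (sound ⟨k, hasMap_pull k Y, h₂.pull_right⟩)

lemma mk_pull_id (X : LongExt N d M) : mk (X.pull (𝟙 M)) = mk X := sound (hasMap_pull _ X)

lemma mk_push_id (X : LongExt N d M) : mk (X.push (𝟙 N)) = mk X := (sound (hasMap_push _ X)).symm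

lemma mk_push_eq {f : N ⟶ N'} {X : LongExt N d M} {Y : LongExt N' d M}
    (h : HasMap f (𝟙 M) X Y) : mk (X.push f) = mk Y :=
  (mk_push_eq_mk_pull h).trans (mk_pull_id Y)

lemma mk_pull_eq {g : M ⟶ M'} {X : LongExt N d M} {Y : LongExt N d M'}
    (h : HasMap (𝟙 N) g X Y) : mk (Y.pull g) = mk X :=
  (mk_push_eq_mk_pull h).symm.trans (mk_push_id X)

/-- Functoriality in the variable `M`. -/
noncomputable def pull (g : M' ⟶ M) : ExtClass M N d → ExtClass M' N d :=
  Quot.lift (fun X => mk (X.pull g)) (by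
    rintro X Y ⟨Z, hX, hY⟩
    have hX' : HasMap (𝟙 N) g (Z.pull g) X := by simpa using HasMap.comp (hasMap_pull g Z) hX
    have hY' : HasMap (𝟙 N) g (Z.pull g) Y := by simpa using HasMap.comp (hasMap_pull g Z) hY
    exact (mk_pull_eq hX').trans (mk_pull_eq hY').symm)

/-- The direct sum of two classes. -/
noncomputable def sum : ExtClass M N d → ExtClass M' N' d → ExtClass (M ⊞ M') (N ⊞ N') d :=
  Quot.map₂ LongExt.sum
    (by
      rintro X Y Y' ⟨Z, h, h'⟩
      exact ⟨X.sum Z, by simpa using HasMap.sum (HasMap.refl X) h,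
        by simpa using HasMap.sum (HasMap.refl X) h'⟩)
    (by
      rintro X X' Y ⟨Z, h, h'⟩
      exact ⟨Z.sum Y, by simpa using HasMap.sum h (HasMap.refl Y),
        by simpa using HasMap.sum h' (HasMap.refl Y)⟩)

lemma push_mk_eq_pull_mk {f : N ⟶ N'} {g : M ⟶ M'} {X : LongExt N d M} {Y : LongExt N' d M'}
    (h : HasMap f g X Y) : push f (mk X) = pull g (mk Y) :=
  mk_push_eq_mk_pull h

lemma push_mk_eq {f : N ⟶ N'} {X : LongExt N d M} {Y : LongExt N' d M}
    (h : HasMap f (𝟙 M) X Y) : push f (mk X) = mk Y :=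
  mk_push_eq h

lemma pull_mk_eq {g : M ⟶ M'} {X : LongExt N d M} {Y : LongExt N d M'}
    (h : HasMap (𝟙 N) g X Y) : pull g (mk Y) = mk X :=
  mk_pull_eq h

@[simp]
lemma push_id (x : ExtClass M N d) : push (𝟙 N) x = x := by
  induction x using ind with | h X
  exact push_mk_eq (HasMap.refl X)

@[simp]
lemma pull_id (x : ExtClass M N d) : pull (𝟙 M) x = x := by
  induction x using ind with | h X
  exact pull_mk_eq (HasMap.refl X)

lemma push_push (f : N ⟶ N') (f' : N' ⟶ N'') (x : ExtClass M N d) :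
    push f' (push f x) = push (f ≫ f') x := by
  induction x using ind with | h X
  exact (push_mk_eq (by
    simpa using HasMap.comp (hasMap_push f X) (hasMap_push f' (X.push f)))).symm

lemma pull_pull (g : M' ⟶ M) (g' : M'' ⟶ M') (x : ExtClass M N d) :
    pull g' (pull g x) = pull (g' ≫ g) x := by
  induction x using ind with | h X
  exact (pull_mk_eq (by
    simpa using HasMap.comp (hasMap_pull g' (X.pull g)) (hasMap_pull g X))).symm

lemma push_pull (f : N ⟶ N') (g : M' ⟶ M) (x : ExtClass M N d) :
    push f (pull g x) = pull g (push f x) := by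
  induction x using ind with | h X
  exact push_mk_eq_pull_mk (by
    simpa using HasMap.comp (hasMap_pull g X) (hasMap_push f X))

lemma sum_push {A A' B : C} (f : N ⟶ N') (f' : A ⟶ A') (x : ExtClass M N d) (y : ExtClass B A d) :
    sum (push f x) (push f' y) = push (biprod.map f f') (sum x y) := by
  induction x using ind with | h X
  induction y using ind with | h Y
  exact (push_mk_eq (by
    simpa using HasMap.sum (hasMap_push f X) (hasMap_push f' Y))).symm

lemma sum_pull {A B B' : C} (g : M' ⟶ M) (g' : B' ⟶ B) (x : ExtClass M N d) (y : ExtClass B A d) :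
    sum (pull g x) (pull g' y) = pull (biprod.map g g') (sum x y) := by
  induction x using ind with | h X
  induction y using ind with | h Y
  exact (pull_mk_eq (by
    simpa using HasMap.sum (hasMap_pull g X) (hasMap_pull g' Y))).symm

/-- The Baer sum. -/
noncomputable instance : Add (ExtClass M N d) where
  add x y := push (biprod.desc (𝟙 N) (𝟙 N)) (pull (biprod.lift (𝟙 M) (𝟙 M)) (sum x y))

noncomputable instance : Zero (ExtClass M N d) where
  zero := mk (trivial N d M)

noncomputable instance : Neg (ExtClass M N d) where
  neg x := push (-𝟙 N) x

lemma add_def (x y : ExtClass M N d) :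
    x + y = push (biprod.desc (𝟙 N) (𝟙 N)) (pull (biprod.lift (𝟙 M) (𝟙 M)) (sum x y)) := rfl

lemma push_diag (x : ExtClass M N d) :
    push (biprod.lift (𝟙 N) (𝟙 N)) x = pull (biprod.lift (𝟙 M) (𝟙 M)) (sum x x) := by
  induction x using ind with | h X
  exact push_mk_eq_pull_mk (hasMap_diag X)

lemma push_zero_hom (x : ExtClass M N d) : push (0 : N ⟶ N') x = 0 := by
  induction x using ind with | h X
  exact push_mk_eq (hasMap_trivial N' (𝟙 M) X)

lemma push_add_hom (f g : N ⟶ N') (x : ExtClass M N d) :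
    push (f + g) x = push f x + push g x := by
  rw [add_def, sum_push, ← push_pull, ← push_diag, push_push, push_push]
  have h : biprod.lift (𝟙 N) (𝟙 N) ≫ biprod.map f g ≫ biprod.desc (𝟙 N') (𝟙 N') = f + g := by
    simp only [biprod.desc_eq]
    simp
  rw [h]

lemma push_add (f : N ⟶ N') (x y : ExtClass M N d) :
    push f (x + y) = push f x + push f y := by
  rw [add_def, add_def, sum_push, ← push_pull, push_push, push_push]
  congr 1
  ext <;> simp

lemma add_comm' (x y : ExtClass M N d) : x + y = y + x := by
  have h : push (biprod.braiding N N).hom (sum x y) =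
      pull (biprod.braiding M M).hom (sum y x) := by
    induction x using ind with | h X
    induction y using ind with | h Y
    exact push_mk_eq_pull_mk (hasMap_swap X Y)
  have h₁ : biprod.desc (𝟙 N) (𝟙 N) = (biprod.braiding N N).hom ≫ biprod.desc (𝟙 N) (𝟙 N) := by
    ext <;> simp
  have h₂ : biprod.lift (𝟙 M) (𝟙 M) ≫ (biprod.braiding M M).hom = biprod.lift (𝟙 M) (𝟙 M) := by
    ext <;> simp
  rw [add_def, add_def]
  conv_lhs => rw [h₁]
  rw [← push_push, push_pull (biprod.braiding N N).hom, h, pull_pull, h₂]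

lemma add_assoc' (x y z : ExtClass M N d) : x + y + z = x + (y + z) := by
  have h : push (biprod.associator N N N).hom (sum (sum x y) z) =
      pull (biprod.associator M M M).hom (sum x (sum y z)) := by
    induction x using ind with | h X
    induction y using ind with | h Y
    induction z using ind with | h Z
    exact push_mk_eq_pull_mk (hasMap_assoc X Y Z)
  have hl : x + y + z = push (biprod.map (biprod.desc (𝟙 N) (𝟙 N)) (𝟙 N) ≫ biprod.desc (𝟙 N) (𝟙 N))
      (pull (biprod.lift (𝟙 M) (𝟙 M) ≫ biprod.map (biprod.lift (𝟙 M) (𝟙 M)) (𝟙 M))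
        (sum (sum x y) z)) := by
    rw [← push_push, ← pull_pull, ← sum_pull, push_pull (biprod.map _ _), ← sum_push,
      push_id, pull_id]
    rfl
  have hr : x + (y + z) =
      push (biprod.map (𝟙 N) (biprod.desc (𝟙 N) (𝟙 N)) ≫ biprod.desc (𝟙 N) (𝟙 N))
      (pull (biprod.lift (𝟙 M) (𝟙 M) ≫ biprod.map (𝟙 M) (biprod.lift (𝟙 M) (𝟙 M)))
        (sum x (sum y z))) := by
    rw [← push_push, ← pull_pull, ← sum_pull, push_pull (biprod.map _ _), ← sum_push,
      push_id, pull_id]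
    rfl
  have h₁ : biprod.map (biprod.desc (𝟙 N) (𝟙 N)) (𝟙 N) ≫ biprod.desc (𝟙 N) (𝟙 N) =
      (biprod.associator N N N).hom ≫
        biprod.map (𝟙 N) (biprod.desc (𝟙 N) (𝟙 N)) ≫ biprod.desc (𝟙 N) (𝟙 N) := by
    simp only [biprod.desc_eq]
    ext <;> simp
  have h₂ : (biprod.lift (𝟙 M) (𝟙 M) ≫ biprod.map (biprod.lift (𝟙 M) (𝟙 M)) (𝟙 M)) ≫
      (biprod.associator M M M).hom =
        biprod.lift (𝟙 M) (𝟙 M) ≫ biprod.map (𝟙 M) (biprod.lift (𝟙 M) (𝟙 M)) := by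
    ext <;> simp
  rw [hl, hr, h₁, ← push_push, push_pull (biprod.associator N N N).hom, h, pull_pull, h₂]

lemma add_zero' (x : ExtClass M N d) : x + 0 = x := by
  have := push_add_hom (𝟙 N) 0 x
  rw [add_zero, push_id, push_zero_hom] at this
  exact this.symm

lemma neg_add' (x : ExtClass M N d) : -x + x = 0 := by
  have := push_add_hom (-𝟙 N) (𝟙 N) x
  rw [neg_add_cancel, push_id, push_zero_hom] at this
  exact this.symm

noncomputable instance : AddCommGroup (ExtClass M N d) where
  add_assoc := add_assoc'
  zero_add x := by rw [add_comm', add_zero']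
  add_zero := add_zero'
  add_comm := add_comm'
  neg_add_cancel := neg_add'
  nsmul := nsmulRec
  zsmul := zsmulRec

variable {D : Type u'} [Category.{v'} D] [Abelian D]
  (F : C ⥤ D) [F.Additive] [PreservesFiniteLimits F] [PreservesFiniteColimits F]

/-- The map induced on classes by an exact functor. -/
def map : ExtClass M N d → ExtClass (F.obj M) (F.obj N) d :=
  Quot.map (LongExt.map F) (by
    rintro X Y ⟨Z, h, h'⟩
    exact ⟨Z.map F, by simpa using HasMap.map F h, by simpa using HasMap.map F h'⟩)

lemma map_push (f : N ⟶ N') (x : ExtClass M N d) : map F (push f x) = push (F.map f) (map F x) := by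
  induction x using ind with | h X
  exact (push_mk_eq (by simpa using HasMap.map F (hasMap_push f X))).symm

lemma map_pull (g : M' ⟶ M) (x : ExtClass M N d) : map F (pull g x) = pull (F.map g) (map F x) := by
  induction x using ind with | h X
  exact (pull_mk_eq (by simpa using HasMap.map F (hasMap_pull g X))).symm

lemma map_add (x y : ExtClass M N d) : map F (x + y) = map F x + map F y := by
  have h : push (biprod.lift (F.map biprod.fst) (F.map biprod.snd)) (map F (sum x y)) =
      pull (biprod.lift (F.map biprod.fst) (F.map biprod.snd)) (sum (map F x) (map F y)) := by
    induction x using ind with | h X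
    induction y using ind with | h Y
    exact push_mk_eq_pull_mk (hasMap_map_sum F X Y)
  have h₁ : F.map (biprod.desc (𝟙 N) (𝟙 N)) =
      biprod.lift (F.map biprod.fst) (F.map biprod.snd) ≫ biprod.desc (𝟙 _) (𝟙 _) := by
    rw [biprod.lift_desc, Category.comp_id, Category.comp_id, ← F.map_add]
    congr 1
    ext <;> simp
  have h₂ : F.map (biprod.lift (𝟙 M) (𝟙 M)) ≫
      biprod.lift (F.map biprod.fst) (F.map biprod.snd) = biprod.lift (𝟙 _) (𝟙 _) := by
    ext <;> simp [← F.map_comp, -Functor.map_comp]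
  rw [add_def, add_def, map_push, map_pull, h₁, ← push_push, push_pull, h, pull_pull, h₂]

end ExtClass

end Sequences

end YonedaExt

open YonedaExt

section YExt

variable {C : Type u} [Category.{v} C] [Abelian C]

/-- The Yoneda extension groups `Extⁿ(M, N)`: morphisms `M ⟶ N` for `n = 0`, and equivalence classes
of exact sequences `0 ⟶ N ⟶ X¹ ⟶ ⋯ ⟶ Xⁿ ⟶ M ⟶ 0` for `n > 0`. -/
def YExt (M N : C) : ℕ → Type (max u v)
  | 0 => ULift.{u} (M ⟶ N)
  | d + 1 => ExtClass M N d

namespace YExt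

variable {M N N' : C}

/-- Addition of morphisms for `n = 0`, the Baer sum for `n > 0`. -/
noncomputable instance : ∀ n : ℕ, AddCommGroup (YExt M N n)
  | 0 => inferInstanceAs (AddCommGroup (ULift.{u} (M ⟶ N)))
  | d + 1 => inferInstanceAs (AddCommGroup (ExtClass M N d))

variable (M) in
/-- The homomorphism `Extⁿ(M, N) ⟶ Extⁿ(M, N')` induced by `f : N ⟶ N'`. -/
noncomputable def push (f : N ⟶ N') : ∀ n : ℕ, YExt M N n →+ YExt M N' n
  | 0 =>
    { toFun := fun x => ULift.up (x.down ≫ f)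
      map_zero' := congrArg ULift.up zero_comp
      map_add' := fun x y => congrArg ULift.up (Preadditive.add_comp _ _ _ x.down y.down f) }
  | _ + 1 => AddMonoidHom.mk' (ExtClass.push f) (ExtClass.push_add f)

/-- The functor `Extⁿ(M, -)`. -/
noncomputable def functor (M : C) (n : ℕ) : C ⥤ AddCommGrpCat.{max u v} where
  obj N := AddCommGrpCat.of (YExt M N n)
  map f := AddCommGrpCat.ofHom (push M f n)
  map_id N := by
    ext x
    cases n with
    | zero => exact congrArg ULift.up (Category.comp_id x.down)
    | succ d => exact ExtClass.push_id (d := d) x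
  map_comp f g := by
    ext x
    cases n with
    | zero => exact congrArg ULift.up (Category.assoc x.down f g).symm
    | succ d => exact (ExtClass.push_push (d := d) f g x).symm

variable {D : Type u'} [Category.{v'} D] [Abelian D]
  (F : C ⥤ D) [F.Additive] [PreservesFiniteLimits F] [PreservesFiniteColimits F]

/-- The homomorphism `Extⁿ(M, N) ⟶ Extⁿ(F M, F N)` induced by an exact functor `F`. -/
noncomputable def map (M N : C) : ∀ n : ℕ, YExt M N n →+ YExt (F.obj M) (F.obj N) n
  | 0 =>
    { toFun := fun x => ULift.up (F.map x.down)
      map_zero' := congrArg ULift.up (F.map_zero M N)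
      map_add' := fun x y => congrArg ULift.up (F.map_add (f := x.down) (g := y.down)) }
  | _ + 1 => AddMonoidHom.mk' (ExtClass.map F) (ExtClass.map_add F)

lemma map_push (M : C) (f : N ⟶ N') (n : ℕ) (x : YExt M N n) :
    map F M N' n (push M f n x) = push (F.obj M) (F.map f) n (map F M N n x) := by
  cases n with
  | zero => exact congrArg ULift.up (F.map_comp x.down f)
  | succ d => exact ExtClass.map_push (d := d) F f x

lemma push_comp (M : C) {N'' : C} (f : N ⟶ N') (g : N' ⟶ N'') (n : ℕ) (x : YExt M N n) :
    push M g n (push M f n x) = push M (f ≫ g) n x :=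
  (ConcreteCategory.congr_hom ((functor M n).map_comp f g) x).symm

end YExt

/-- An abelian subcategory, given by a fully faithful exact functor `F : B ⥤ A`, is extension full
if the homomorphisms `Extⁿ_B(M, N) ⟶ Extⁿ_A(M, N)` are bijective for all `M`, `N` and `n`. -/
def IsExtensionFull {B : Type u} [Category.{v} B] [Abelian B] {A : Type u'} [Category.{v'} A]
    [Abelian A] (F : B ⥤ A) [F.Full] [F.Faithful] [F.Additive] [PreservesFiniteLimits F]
    [PreservesFiniteColimits F] : Prop :=
  ∀ (M N : B) (n : ℕ), Function.Bijective (YExt.map F M N n)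

end YExt

section IndPro

lemma CategoryTheory.Ind.preservesFiniteLimits_of_isIndObject {C : Type u} [Category.{v} C]
    (X : Cᵒᵖ ⥤ Type v) (hX : IsIndObject X) :
    PreservesFiniteLimits X := by
  let P := hX.presentation
  have : PreservesFiniteLimits ((P.F ⋙ yoneda).flip ⋙ colim) := by
    have : PreservesFiniteLimits (P.F ⋙ yoneda).flip :=
      ⟨fun J _ _ => preservesLimitsOfShape_of_evaluation _ _
        (fun i => inferInstanceAs (PreservesLimitsOfShape J (yoneda.obj (P.F.obj i))))⟩
    infer_instance
  exact preservesFiniteLimits_of_natIso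
    ((colimitIsoFlipCompColim _).symm ≪≫ (colimit.isColimit _).coconePointUniqueUpToIso P.isColimit)

variable {C : Type u} [Category.{v} C] [Abelian C]

namespace CategoryTheory.Ind

variable (C) in
noncomputable def toLeftExactFunctor : Ind C ⥤ (Cᵒᵖ ⥤ₗ Type v) :=
  ObjectProperty.lift _ (Ind.inclusion C)
    (fun X => preservesFiniteLimits_of_isIndObject _ X.isIndObject_inclusion_obj)

variable (C) in
noncomputable def toLeftExactFunctorFullyFaithful : (toLeftExactFunctor C).FullyFaithful :=
  Functor.FullyFaithful.ofCompFaithful (G := ObjectProperty.ι _)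
    (Ind.inclusion.fullyFaithful (C := C))

noncomputable instance preadditive : Preadditive (Ind C) :=
  have : HasFiniteBiproducts Cᵒᵖ := HasFiniteBiproducts.of_hasFiniteProducts
  .ofFullyFaithful (((toLeftExactFunctorFullyFaithful C).comp
    (AddCommGrpCat.leftExactFunctorForgetEquivalence Cᵒᵖ).symm.fullyFaithfulFunctor).comp
      (ObjectProperty.fullyFaithfulι _))

instance : HasFiniteBiproducts (Ind C) :=
  HasFiniteBiproducts.of_hasFiniteCoproducts

open CategoryTheory.Abelian in
instance isIso_coimageImageComparison {X Y : Ind C} (f : X ⟶ Y) :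
    IsIso (Abelian.coimageImageComparison f) := by
  obtain ⟨I, _, _, F, G, ϕ, ⟨i⟩⟩ := Ind.exists_nonempty_arrow_mk_iso_ind_lim (f := f)
  let i' : Arrow.mk (coimageImageComparison f) ≅
      Arrow.mk (coimageImageComparison ((Ind.lim I).map ϕ)) :=
    coimageImageComparisonFunctor.mapIso i
  have := Iso.isIso_hom i'
  rw [Arrow.isIso_iff_isIso_of_isIso i'.hom,
    Arrow.isIso_iff_isIso_of_isIso (PreservesCoimageImageComparison.iso (Ind.lim I) ϕ).inv]
  infer_instance

noncomputable instance abelian : Abelian (Ind C) :=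
  .ofCoimageImageComparisonIsIso

instance : PreservesFiniteLimits (Ind.yoneda (C := C)) := inferInstance
instance : (Ind.yoneda (C := C)).Additive := Functor.additive_of_preserves_binary_products _

end CategoryTheory.Ind


variable (C) in
/-- The category of pro-objects of `C`: the opposite of the category of ind-objects of `Cᵒᵖ`. -/
abbrev Pro : Type (max u (v + 1)) := (Ind Cᵒᵖ)ᵒᵖ

/-- The embedding `C ⥤ Pro C`. -/
noncomputable abbrev Pro.embedding : C ⥤ Pro C := (Ind.yoneda (C := Cᵒᵖ)).rightOp

instance : PreservesFiniteLimits (Pro.embedding (C := C)) := preservesFiniteLimits_rightOp _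
instance : PreservesFiniteColimits (Pro.embedding (C := C)) := preservesFiniteColimits_rightOp _

/-- For a diagram `F : I ⥤ C` and a cocone with point `Y` over its image in `Ind C`, the canonical
homomorphisms `Extⁿ_C(Z, F i) ⟶ Extⁿ_{Ind C}(Z, F i) ⟶ Extⁿ_{Ind C}(Z, Y)`, as a cocone (the groups
`Extⁿ_C(Z, F i)` are lifted to the universe of `Extⁿ_{Ind C}(Z, Y)`). -/
noncomputable def extCocone {I : Type v} [SmallCategory I] (F : I ⥤ C)
    (c : Cocone (F ⋙ Ind.yoneda)) (Z : C) (n : ℕ) :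
    Cocone (F ⋙ YExt.functor Z n ⋙ AddCommGrpCat.uliftFunctor.{v + 1, max u v}) where
  pt := AddCommGrpCat.of (YExt (Ind.yoneda.obj Z) c.pt n)
  ι :=
    { app := fun i => AddCommGrpCat.ofHom
        (((YExt.push (Ind.yoneda.obj Z) (c.ι.app i) n).comp
          (YExt.map Ind.yoneda Z (F.obj i) n)).comp AddEquiv.ulift.toAddMonoidHom)
      naturality := fun i j f => by
        ext x
        have h := YExt.map_push Ind.yoneda Z (F.map f) n x.down
        have h' := YExt.push_comp (Ind.yoneda.obj Z) (Ind.yoneda.map (F.map f)) (c.ι.app j) n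
          (YExt.map Ind.yoneda Z (F.obj i) n x.down)
        have h'' : Ind.yoneda.map (F.map f) ≫ c.ι.app j = c.ι.app i := c.w f
        rw [h''] at h'
        exact (congrArg (YExt.push (Ind.yoneda.obj Z) (c.ι.app j) n) h).trans h' }

end IndPro

/-! Everything is dimension shifting in the first variable. A class in `Extⁿ⁺¹(M, N)` is the splice
of a short exact sequence `0 ⟶ K ⟶ E ⟶ M ⟶ 0` with a class in `Extⁿ(K, N)`. Such a splice vanishes
only if, over some `0 ⟶ L ⟶ P ⟶ M ⟶ 0` mapping to `E`, the class restricted to `L` extends to `P`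
(`YExt.exists_of_conn_eq_zero`). In effect `Extⁿ⁺¹(M, N)` is the colimit, over short exact sequences
ending in `M`, of the cokernels of `Extⁿ(P, N) ⟶ Extⁿ(L, N)`.

If `M` lies in `C`, the sequences from `C` suffice for this colimit in `Ind C`, because an
epimorphism from an ind-object onto `M` restricts to an epimorphism from an object of `C`
(`Ind.exists_epi_comp`). Induction on `n` then reduces (2) to `n = 0`, where it says that objects of
`C` are compact in `Ind C`. The induction is carried out for an abstract fully faithful exact
functor in `YExt.exists_push_map` (surjectivity) and `YExt.exists_push_eq_zero` (injectivity).

Part (1) for `Ind C` is the case of a one-point diagram. For `Pro C` it follows by reversing exact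
sequences. -/

namespace YonedaExt

section

variable {C : Type u} [Category.{v} C] [Abelian C]

/-! ### Comparison of short exact sequences; additivity of Ext in the first variable -/

namespace ShortExt

/-- The short exact sequence `0 ⟶ ker g ⟶ E ⟶ M ⟶ 0` of an epimorphism `g : E ⟶ M`. -/
noncomputable def ofEpi {E M : C} (g : E ⟶ M) [Epi g] : ShortExt M (kernel g) where
  E := E
  i := kernel.ι g
  p := g
  zero := kernel.condition g
  exact := shortExact_of_lift _ _ _ fun k hk => ⟨kernel.lift g k hk, kernel.lift_ι g k hk⟩

lemma exists_comp_i {M K K' : C} (E : ShortExt M K) (E' : ShortExt M K') (e : E.E ⟶ E'.E)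
    (he : e ≫ E'.p = E.p) : ∃ k : K ⟶ K', E.i ≫ e = k ≫ E'.i := by
  obtain ⟨k, hk⟩ := E'.exists_lift (E.i ≫ e) (by rw [Category.assoc, he, E.zero])
  exact ⟨k, hk.symm⟩

/-- Any two short exact sequences ending in `M` are dominated by a third one. -/
lemma exists_common {M K K' : C} (E : ShortExt M K) (E' : ShortExt M K') :
    ∃ (L : C) (P : ShortExt M L) (e : P.E ⟶ E.E) (e' : P.E ⟶ E'.E),
      e ≫ E.p = P.p ∧ e' ≫ E'.p = P.p :=
  ⟨_, ofEpi (pullback.fst E.p E'.p ≫ E.p), pullback.fst E.p E'.p, pullback.snd E.p E'.p, rfl,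
    pullback.condition.symm⟩

/-- The pushout of a sequence along its own inclusion splits; this is why classes extending to the
middle object are killed by the connecting map. -/
lemma hasMap_split_i {M K : C} (E : ShortExt M K) : E.HasMap E.i (𝟙 M) (split M E.E) :=
  ⟨biprod.lift (𝟙 _) E.p, by dsimp only [split]; ext <;> simp [E.zero], by simp [split]⟩

lemma idSeq_hasMap_split (M K : C) : (idSeq M).HasMap (0 : 0 ⟶ K) (𝟙 M) (split M K) := by
  refine ⟨(biprod.inr : M ⟶ K ⊞ M), ?_, ?_⟩ <;> simp [idSeq, split]

lemma hasMap_codiag {M N : C} (X : ShortExt M N) :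
    (X.sum X).HasMap (biprod.desc (𝟙 N) (𝟙 N)) (biprod.desc (𝟙 M) (𝟙 M)) X :=
  ⟨biprod.desc (𝟙 _) (𝟙 _), by dsimp only [sum]; ext <;> simp, by dsimp only [sum]; ext <;> simp⟩

end ShortExt

lemma LongExt.hasMap_codiag {N : C} : ∀ {d : ℕ} {M : C} (X : LongExt N d M),
    HasMap (biprod.desc (𝟙 N) (𝟙 N)) (biprod.desc (𝟙 M) (𝟙 M)) (X.sum X) X
  | _, _, single E => E.hasMap_codiag
  | _, _, splice X E => ⟨_, hasMap_codiag X, E.hasMap_codiag⟩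

namespace ExtClass

open LongExt

variable {M M' N N' : C} {d : ℕ}

lemma push_codiag (x : ExtClass M N d) :
    push (biprod.desc (𝟙 N) (𝟙 N)) (sum x x) = pull (biprod.desc (𝟙 M) (𝟙 M)) x := by
  induction x using ind with | h X
  exact push_mk_eq_pull_mk (hasMap_codiag X)

/-- The sum `f + g` is diagonal, then `f ⊕ g`, then codiagonal, and by `push_codiag` the codiagonal
may be moved from `M` to `N`, where it computes the Baer sum. -/
lemma pull_add_hom (f g : M' ⟶ M) (x : ExtClass M N d) :
    pull (f + g) x = pull f x + pull g x := by
  have h : (biprod.lift (𝟙 M') (𝟙 M') ≫ biprod.map f g) ≫ biprod.desc (𝟙 M) (𝟙 M) = f + g := by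
    rw [show biprod.lift (𝟙 M') (𝟙 M') ≫ biprod.map f g = biprod.lift f g by ext <;> simp,
      biprod.lift_desc, Category.comp_id, Category.comp_id]
  rw [add_def, sum_pull, pull_pull, push_pull, push_codiag, pull_pull, h]

lemma pull_add (g : M' ⟶ M) (x y : ExtClass M N d) :
    pull g (x + y) = pull g x + pull g y := by
  have h : biprod.lift (𝟙 M') (𝟙 M') ≫ biprod.map g g = g ≫ biprod.lift (𝟙 M) (𝟙 M) := by
    ext <;> simp
  rw [add_def, add_def, sum_pull, pull_pull, h, ← push_pull, pull_pull]

/-- The connecting map given by a short exact sequence. -/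
def splice {K : C} (E : ShortExt M K) : ExtClass K N d → ExtClass M N (d + 1) :=
  Quot.lift (fun X => mk (LongExt.splice X E)) fun _ _ h =>
    mk_splice_congr (sound' h) E

end ExtClass

end

end YonedaExt

/-! ### Connecting maps and their kernels -/

namespace YExt

section

variable {C : Type u} [Category.{v} C] [Abelian C] {M M' M'' N N' : C}

variable (N) in
/-- The homomorphism `Extⁿ(M, N) ⟶ Extⁿ(M', N)` induced by `g : M' ⟶ M`. -/
noncomputable def pull (g : M' ⟶ M) : ∀ n : ℕ, YExt M N n →+ YExt M' N n
  | 0 =>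
    { toFun := fun x => ULift.up (g ≫ x.down)
      map_zero' := congrArg ULift.up comp_zero
      map_add' := fun x y => congrArg ULift.up (Preadditive.comp_add _ _ _ g x.down y.down) }
  | _ + 1 => AddMonoidHom.mk' (ExtClass.pull g) (ExtClass.pull_add g)

lemma push_id (n : ℕ) (x : YExt M N n) : push M (𝟙 N) n x = x :=
  ConcreteCategory.congr_hom ((functor M n).map_id N) x

lemma pull_id (n : ℕ) (x : YExt M N n) : pull N (𝟙 M) n x = x := by
  cases n with
  | zero => exact congrArg ULift.up (Category.id_comp x.down)
  | succ d => exact ExtClass.pull_id (d := d) x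

lemma pull_pull (g : M' ⟶ M) (g' : M'' ⟶ M') (n : ℕ) (x : YExt M N n) :
    pull N g' n (pull N g n x) = pull N (g' ≫ g) n x := by
  cases n with
  | zero => exact congrArg ULift.up (Category.assoc g' g x.down).symm
  | succ d => exact ExtClass.pull_pull (d := d) g g' x

lemma push_pull (f : N ⟶ N') (g : M' ⟶ M) (n : ℕ) (x : YExt M N n) :
    push M' f n (pull N g n x) = pull N' g n (push M f n x) := by
  cases n with
  | zero => exact congrArg ULift.up (Category.assoc g x.down f)
  | succ d => exact ExtClass.push_pull (d := d) f g x

lemma pull_add_hom (f g : M' ⟶ M) (n : ℕ) (x : YExt M N n) :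
    pull N (f + g) n x = pull N f n x + pull N g n x := by
  cases n with
  | zero => exact congrArg ULift.up (Preadditive.add_comp _ _ _ f g x.down)
  | succ d => exact ExtClass.pull_add_hom (d := d) f g x

lemma pull_zero_hom (n : ℕ) (x : YExt M N n) : pull N (0 : M' ⟶ M) n x = 0 := by
  simpa using pull_add_hom (0 : M' ⟶ M) 0 n x

/-- The connecting map `Extⁿ(K, N) ⟶ Extⁿ⁺¹(M, N)` given by a short exact sequence
`0 ⟶ K ⟶ E ⟶ M ⟶ 0`. -/
noncomputable def conn {K : C} (E : ShortExt M K) : ∀ {n : ℕ}, YExt K N n → YExt M N (n + 1)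
  | 0, x => ExtClass.push x.down (ExtClass.mk (LongExt.single E))
  | _ + 1, x => ExtClass.splice E x

/-- The last short exact sequence of an exact sequence, with the class of the rest. -/
def last : ∀ {n : ℕ} {M : C}, LongExt N n M → Σ K : C, ShortExt M K × YExt K N n
  | _, _, LongExt.single E => ⟨N, E, ULift.up (𝟙 N)⟩
  | _, _, LongExt.splice X E => ⟨_, E, ExtClass.mk X⟩

lemma conn_last : ∀ {n : ℕ} {M : C} (X : LongExt N n M),
    (conn (last X).2.1 (last X).2.2 : YExt M N (n + 1)) = ExtClass.mk X
  | _, _, LongExt.single E => ExtClass.push_id (ExtClass.mk (LongExt.single E))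
  | _, _, LongExt.splice _ _ => rfl

lemma exists_conn {n : ℕ} (y : YExt M N (n + 1)) :
    ∃ (K : C) (E : ShortExt M K) (x : YExt K N n), y = conn E x := by
  obtain ⟨X, rfl⟩ := Quot.exists_rep (r := Rel (N := N) (M := M) (d := n)) y
  exact ⟨_, _, _, (conn_last X).symm⟩

lemma push_conn {K : C} (E : ShortExt M K) (f : N ⟶ N') {n : ℕ} (x : YExt K N n) :
    push M f (n + 1) (conn E x) = conn E (push K f n x) := by
  cases n with
  | zero => exact ExtClass.push_push x.down f (ExtClass.mk (LongExt.single E))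
  | succ d =>
    obtain ⟨X, rfl⟩ := Quot.exists_rep (r := Rel (N := N) (M := K) (d := d)) x
    rfl

/-- Associativity of the Yoneda product: a morphism over the identity of `M` makes `E'` the pushout
of `E` along `k`. This rule allows `E` to be replaced by any sequence mapping to it. -/
lemma conn_pull {K K' : C} {E : ShortExt M K} {E' : ShortExt M K'} {k : K ⟶ K'}
    (h : E.HasMap k (𝟙 M) E') {n : ℕ} (x : YExt K' N n) : conn E (pull N k n x) = conn E' x := by
  cases n with
  | zero =>
    refine (ExtClass.push_push k x.down _).symm.trans (congrArg (ExtClass.push x.down) ?_)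
    exact ExtClass.push_mk_eq (X := LongExt.single E) (Y := LongExt.single E') h
  | succ d =>
    obtain ⟨X, rfl⟩ := Quot.exists_rep (r := Rel (N := N) (M := K') (d := d)) x
    exact ExtClass.sound ⟨k, LongExt.hasMap_pull k X, h⟩

lemma conn_split (K : C) {n : ℕ} (x : YExt K N n) : conn (ShortExt.split M K) x = 0 := by
  cases n with
  | zero =>
    exact ExtClass.push_mk_eq (X := LongExt.trivial K 0 M) (Y := LongExt.trivial N 0 M)
      ⟨biprod.map x.down (𝟙 M), by simp [ShortExt.split], by simp [ShortExt.split]⟩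
  | succ d =>
    -- The class is moved to the sequence with kernel `0`, where it becomes zero; the zero class of
    -- `Extᵈ⁺²` is by definition the splice of a trivial sequence with `idSeq M`.
    rw [← conn_pull (ShortExt.idSeq_hasMap_split M K), pull_zero_hom]
    rfl

lemma conn_pull_i {K : C} (E : ShortExt M K) {n : ℕ} (x : YExt E.E N n) :
    conn E (pull N E.i n x) = 0 := by
  rw [conn_pull E.hasMap_split_i, conn_split]

/-- Pairs of a short exact sequence `0 ⟶ K ⟶ E ⟶ M ⟶ 0` and a class in `Extⁿ(K, N)` which become
equal over a third short exact sequence, up to classes extending to its middle object. -/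
def ConnRel {n : ℕ} (a b : Σ K : C, ShortExt M K × YExt K N n) : Prop :=
  ∃ (L : C) (P : ShortExt M L) (k : L ⟶ a.1) (k' : L ⟶ b.1) (w : YExt P.E N n),
    P.HasMap k (𝟙 M) a.2.1 ∧ P.HasMap k' (𝟙 M) b.2.1 ∧
      pull N k n a.2.2 = pull N k' n b.2.2 + pull N P.i n w

lemma ConnRel.symm {n : ℕ} {a b : Σ K : C, ShortExt M K × YExt K N n} (h : ConnRel a b) :
    ConnRel b a := by
  obtain ⟨L, P, k, k', w, h, h', hw⟩ := h
  exact ⟨L, P, k', k, -w, h', h, by rw [hw, _root_.map_neg]; abel⟩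

/-- Over a common refinement `P` of the two witnesses there are two maps to the middle object of
`b`. They differ by a map `t` into the kernel, so the induced maps on kernels differ by `P.i ≫ t`,
and the discrepancy between the two pullbacks of the class of `b` extends to `P`. -/
lemma ConnRel.trans {n : ℕ} {a b c : Σ K : C, ShortExt M K × YExt K N n} (h₁ : ConnRel a b)
    (h₂ : ConnRel b c) : ConnRel a c := by
  obtain ⟨L₁, P₁, k₁, k₁', w₁, h₁, ⟨e₁, h₁', h₁''⟩, hw₁⟩ := h₁
  obtain ⟨L₂, P₂, k₂, k₂', w₂, ⟨e₂, h₂, h₂''⟩, h₂', hw₂⟩ := h₂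
  obtain ⟨L, P, f₁, f₂, hf₁, hf₂⟩ := P₁.exists_common P₂
  obtain ⟨l₁, hl₁⟩ := P.exists_comp_i P₁ f₁ hf₁
  obtain ⟨l₂, hl₂⟩ := P.exists_comp_i P₂ f₂ hf₂
  rw [Category.comp_id] at h₁'' h₂''
  obtain ⟨t, ht⟩ := b.2.1.exists_lift (f₁ ≫ e₁ - f₂ ≫ e₂) (by
    rw [Preadditive.sub_comp, Category.assoc, Category.assoc, h₁'', h₂'', hf₁, hf₂, sub_self])
  have hi : l₁ ≫ k₁' = l₂ ≫ k₂ + P.i ≫ t := by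
    rw [← cancel_mono b.2.1.i, Preadditive.add_comp, Category.assoc, Category.assoc, Category.assoc,
      ht, Preadditive.comp_sub, ← h₁', ← h₂, ← reassoc_of% hl₁, ← reassoc_of% hl₂]
    abel
  refine ⟨L, P, l₁ ≫ k₁, l₂ ≫ k₂', pull N f₂ n w₂ + pull N t n b.2.2 + pull N f₁ n w₁, ?_, ?_, ?_⟩
  · simpa using ShortExt.HasMap.comp (g := 𝟙 M) ⟨f₁, hl₁, by simpa using hf₁⟩ h₁
  · simpa using ShortExt.HasMap.comp (g := 𝟙 M) ⟨f₂, hl₂, by simpa using hf₂⟩ h₂'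
  · rw [← pull_pull, hw₁, _root_.map_add, pull_pull, hi, pull_add_hom, ← pull_pull k₂ l₂, hw₂]
    simp only [_root_.map_add, pull_pull, hl₁, hl₂]
    abel

lemma connRel_of_hasMap {n : ℕ} {K K' : C} {E : ShortExt M K} {E' : ShortExt M K'} {k : K ⟶ K'}
    (h : E.HasMap k (𝟙 M) E') (x : YExt K' N n) :
    ConnRel ⟨K, E, pull N k n x⟩ ⟨K', E', x⟩ :=
  ⟨K, E, 𝟙 _, k, 0, ShortExt.HasMap.refl E, h, by rw [pull_id, map_zero, add_zero]⟩

lemma ConnRel.refl {n : ℕ} (a : Σ K : C, ShortExt M K × YExt K N n) : ConnRel a a := by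
  simpa [pull_id] using connRel_of_hasMap (ShortExt.HasMap.refl a.2.1) a.2.2

lemma connRel_last_of_hasMap : ∀ {n : ℕ} {M : C} {X Y : LongExt N n M},
    LongExt.HasMap (𝟙 N) (𝟙 M) X Y → ConnRel (last X) (last Y)
  | _, _, LongExt.single E, LongExt.single E', h => by
    have := connRel_of_hasMap (n := 0) h (ULift.up (𝟙 N))
    have e : pull N (𝟙 N) 0 (ULift.up (𝟙 N)) = ULift.up (𝟙 N) := pull_id 0 _
    rwa [e] at this
  | _, _, LongExt.splice (d := d) X E, LongExt.splice Y E', h => by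
    obtain ⟨k, h, h'⟩ := h
    have := connRel_of_hasMap (n := d + 1) h' (ExtClass.mk Y)
    have e : pull N k (d + 1) (ExtClass.mk Y) = ExtClass.mk X := ExtClass.pull_mk_eq h
    rwa [e] at this

lemma connRel_last {n : ℕ} {X Y : LongExt N n M} (h : ExtClass.mk X = ExtClass.mk Y) :
    ConnRel (last X) (last Y) := by
  -- Equality of classes only gives a zigzag of morphisms; since `ConnRel` is an equivalence
  -- relation, one morphism at a time is enough.
  have h' : Relation.EqvGen Rel X Y := Quot.eqvGen_exact h
  clear h
  induction h' with
  | rel X Y h =>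
    obtain ⟨Z, h, h'⟩ := h
    exact (connRel_last_of_hasMap h).symm.trans (connRel_last_of_hasMap h')
  | refl X => exact .refl _
  | symm X Y _ ih => exact ih.symm
  | trans X Y Z _ _ ih ih' => exact ih.trans ih'

lemma connRel_last_trivial : ∀ (n : ℕ) (M : C),
    ∃ (K : C) (E : ShortExt M K), ConnRel (last (LongExt.trivial N n M)) ⟨K, E, 0⟩
  -- In length one the class split off is the identity of `N`, not zero, but it extends to `N ⊞ M`
  -- by the first projection.
  | 0, M => ⟨N, ShortExt.split M N, N, ShortExt.split M N, 𝟙 N, 𝟙 N, ULift.up biprod.fst,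
      ShortExt.HasMap.refl _, ShortExt.HasMap.refl _, by
        rw [map_zero, zero_add]
        exact congrArg ULift.up ((Category.id_comp (𝟙 N)).trans biprod.inl_fst.symm)⟩
  | n + 1, M => ⟨0, ShortExt.idSeq M, .refl _⟩

/-- For `n = 0` the connecting map pushes `E` out along `x`, so the last piece of the representative
is not the given pair but only related to it. -/
lemma exists_connRel_last {K : C} (E : ShortExt M K) {n : ℕ} (x : YExt K N n) :
    ∃ X : LongExt N n M, conn E x = ExtClass.mk X ∧ ConnRel ⟨K, E, x⟩ (last X) := by
  cases n with
  | zero =>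
    refine ⟨LongExt.single (E.push x.down), rfl, ?_⟩
    have := connRel_of_hasMap (n := 0) (E.hasMap_push x.down) (ULift.up (𝟙 N))
    have e : pull N x.down 0 (ULift.up (𝟙 N)) = x := congrArg ULift.up (Category.comp_id x.down)
    rwa [e] at this
  | succ d =>
    obtain ⟨X, rfl⟩ := Quot.exists_rep (r := Rel (N := N) (M := K) (d := d)) x
    exact ⟨LongExt.splice X E, rfl, .refl _⟩

/-- If a class in `Extⁿ(K, N)` is killed by the connecting map of `0 ⟶ K ⟶ E ⟶ M ⟶ 0`, then its
pullback to some short exact sequence `0 ⟶ L ⟶ P ⟶ M ⟶ 0` extends to `P`. -/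
lemma exists_of_conn_eq_zero {K : C} {E : ShortExt M K} {n : ℕ} {x : YExt K N n}
    (h : conn E x = 0) : ∃ (L : C) (P : ShortExt M L) (k : L ⟶ K) (w : YExt P.E N n),
      P.HasMap k (𝟙 M) E ∧ pull N k n x = pull N P.i n w := by
  obtain ⟨X, hX, hr⟩ := exists_connRel_last E x
  obtain ⟨K', E', hr'⟩ := connRel_last_trivial (N := N) n M
  obtain ⟨L, P, k, k', w, h₁, -, h₂⟩ := (hr.trans (connRel_last (hX.symm.trans h))).trans hr'
  exact ⟨L, P, k, w, h₁, by rw [h₂, map_zero, zero_add]⟩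

variable {D : Type u'} [Category.{v'} D] [Abelian D]
  (F : C ⥤ D) [F.Additive] [PreservesFiniteLimits F] [PreservesFiniteColimits F]

lemma map_pull (N : C) (g : M' ⟶ M) (n : ℕ) (x : YExt M N n) :
    map F M' N n (pull N g n x) = pull (F.obj N) (F.map g) n (map F M N n x) := by
  cases n with
  | zero => exact congrArg ULift.up (F.map_comp g x.down)
  | succ d => exact ExtClass.map_pull (d := d) F g x

lemma map_conn {K : C} (E : ShortExt M K) {n : ℕ} (x : YExt K N n) :
    map F M N (n + 1) (conn E x) = conn (E.map F) (map F K N n x) := by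
  cases n with
  | zero => exact ExtClass.map_push F x.down (ExtClass.mk (LongExt.single E))
  | succ d =>
    obtain ⟨X, rfl⟩ := Quot.exists_rep (r := Rel (N := N) (M := K) (d := d)) x
    rfl

end

/-! ### Dimension shifting along a fully faithful exact functor -/

section Dominating

variable {B : Type u} [Category.{v} B] [Abelian B] {A : Type u'} [Category.{v'} A]
  [Abelian A] (F : B ⥤ A) [F.Full] [F.Faithful] [F.Additive] [PreservesFiniteLimits F]
  [PreservesFiniteColimits F]

/-- The dominating epimorphism `F Y ⟶ F M` comes from `B` by fullness and is an epimorphism there by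
faithfulness; its kernel gives the sequence. -/
lemma exists_shortExt_hasMap
    (hF : ∀ {X : A} {M : B} (p : X ⟶ F.obj M) [Epi p], ∃ (Y : B) (f : F.obj Y ⟶ X), Epi (f ≫ p))
    {M : B} {K : A} (E : ShortExt (F.obj M) K) :
    ∃ (L : B) (P : ShortExt M L) (k : F.obj L ⟶ K), (P.map F).HasMap k (𝟙 _) E := by
  obtain ⟨Y, f, hf⟩ := hF E.p
  obtain ⟨g, hg⟩ := F.map_surjective (f ≫ E.p)
  have : Epi g := F.epi_of_epi_map (by rwa [hg])
  obtain ⟨k, hk⟩ := ((ShortExt.ofEpi g).map F).exists_comp_i E f hg.symm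
  exact ⟨_, ShortExt.ofEpi g, k, f, hk, by rw [Category.comp_id]; exact hg.symm⟩

lemma hasMap_of_map {M L K : B} {P : ShortExt M L} {E : ShortExt M K} {k : F.obj L ⟶ F.obj K}
    (h : (P.map F).HasMap k (𝟙 _) (E.map F)) :
    ∃ k₀ : L ⟶ K, F.map k₀ = k ∧ P.HasMap k₀ (𝟙 M) E := by
  obtain ⟨e, h, h'⟩ := h
  obtain ⟨k, rfl⟩ := F.map_surjective k
  obtain ⟨e, rfl⟩ := F.map_surjective e
  refine ⟨k, rfl, e, F.map_injective ?_, F.map_injective ?_⟩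
  · rw [F.map_comp, F.map_comp]; exact h
  · rw [F.map_comp, F.map_comp, F.map_id]; exact h'

variable {I : Type*} [Category I] (G : I ⥤ B) {N : A} (φ : ∀ i, F.obj (G.obj i) ⟶ N)

/-- Split a class as `conn E x` and dominate `E` by a sequence `P` from `B`: by `conn_pull` the
class is also the connecting image under `P` of a class of lower degree, which comes from a stage by
induction. -/
lemma exists_push_map
    (hF : ∀ {X : A} {M : B} (p : X ⟶ F.obj M) [Epi p], ∃ (Y : B) (f : F.obj Y ⟶ X), Epi (f ≫ p))
    (hfac : ∀ {K : B} (g : F.obj K ⟶ N), ∃ (i : I) (g₀ : K ⟶ G.obj i), F.map g₀ ≫ φ i = g)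
    (n : ℕ) : ∀ (Z : B) (x : YExt (F.obj Z) N n),
      ∃ (i : I) (y : YExt Z (G.obj i) n), push _ (φ i) n (map F Z (G.obj i) n y) = x := by
  induction n with
  | zero =>
    intro Z x
    obtain ⟨i, g, hg⟩ := hfac x.down
    exact ⟨i, ULift.up g, congrArg ULift.up hg⟩
  | succ n ih =>
    intro Z x
    obtain ⟨K, E, x, rfl⟩ := exists_conn x
    obtain ⟨L, P, k, h⟩ := exists_shortExt_hasMap F hF E
    obtain ⟨i, y, hy⟩ := ih L (pull _ k n x)
    exact ⟨i, conn P y, by rw [map_conn, push_conn, ← conn_pull h, ← hy]⟩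

lemma exists_push_eq_zero [IsFiltered I]
    (hφ : ∀ {i j : I} (f : i ⟶ j), F.map (G.map f) ≫ φ j = φ i)
    (hF : ∀ {X : A} {M : B} (p : X ⟶ F.obj M) [Epi p], ∃ (Y : B) (f : F.obj Y ⟶ X), Epi (f ≫ p))
    (hfac : ∀ {K : B} (g : F.obj K ⟶ N), ∃ (i : I) (g₀ : K ⟶ G.obj i), F.map g₀ ≫ φ i = g)
    (hzero : ∀ {K : B} {i : I} (g : K ⟶ G.obj i), F.map g ≫ φ i = 0 →
      ∃ (j : I) (f : i ⟶ j), g ≫ G.map f = 0)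
    (n : ℕ) : ∀ (Z : B) (i : I) (x : YExt Z (G.obj i) n),
      push _ (φ i) n (map F Z (G.obj i) n x) = 0 →
        ∃ (j : I) (f : i ⟶ j), push Z (G.map f) n x = 0 := by
  induction n with
  | zero =>
    intro Z i x hx
    obtain ⟨j, f, h⟩ := hzero x.down (congrArg ULift.down hx)
    exact ⟨j, f, congrArg ULift.up h⟩
  | succ n ih =>
    intro Z i x hx
    obtain ⟨K, E, x, rfl⟩ := exists_conn x
    rw [map_conn, push_conn] at hx
    -- The vanishing in `A` is witnessed over some `P'` in `A`; dominating `P'` by a sequence `P`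
    -- from `B` brings the witness, up to the class `w`, back to `B`.
    obtain ⟨L', P', k', w, h', hw⟩ := exists_of_conn_eq_zero hx
    obtain ⟨L, P, l, h⟩ := exists_shortExt_hasMap F hF P'
    obtain ⟨k, hk, hP⟩ := hasMap_of_map F (by simpa using h.comp h')
    obtain ⟨e, he⟩ : ∃ e : F.obj P.E ⟶ P'.E, F.map P.i ≫ e = l ≫ P'.i := ⟨h.choose, h.choose_spec.1⟩
    -- The restriction of `w` to the middle object of `P` comes from a class `y` at a stage `j`, by
    -- surjectivity in degree `n`.
    obtain ⟨j, y, hy⟩ := exists_push_map F G φ hF hfac n P.E (pull _ e n w)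
    let s := IsFiltered.max i j
    have hs (i : I) (f : i ⟶ s) {Z : B} (x : YExt Z (G.obj i) n) :
        push _ (φ s) n (map F Z (G.obj s) n (push Z (G.map f) n x)) =
          push _ (φ i) n (map F Z (G.obj i) n x) := by
      rw [map_push, push_comp, hφ]
    -- At the common stage `s`, the restriction of `x` to `L` and that of `y` agree after mapping to
    -- `N`, so by induction they agree at a later stage `t`. There the restriction of `x` extends to
    -- the middle object of `P`, and its connecting image is zero by `conn_pull_i`.
    obtain ⟨t, f, hf⟩ := ih L s (push _ (G.map (IsFiltered.leftToMax i j)) n (pull _ k n x) -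
        pull _ P.i n (push _ (G.map (IsFiltered.rightToMax i j)) n y)) (by
      rw [← push_pull, _root_.map_sub, _root_.map_sub, hs, hs, map_pull, map_pull, push_pull,
        push_pull, hy, hk, ← pull_pull, pull_pull e, he, ← pull_pull, ← hw, sub_self])
    refine ⟨t, IsFiltered.leftToMax i j ≫ f, ?_⟩
    rw [_root_.map_sub, sub_eq_zero] at hf
    rw [push_conn, ← conn_pull hP, ← push_pull, G.map_comp, ← push_comp, hf, push_pull,
      conn_pull_i]

end Dominating

end YExt

/-! ### Compactness of objects of `C` in `Ind C`, and epimorphisms onto them -/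

namespace CategoryTheory.Ind

variable {C : Type u} [Category.{v} C]

/-- Morphisms from an object `K` of `C` to an ind-object `X` are the elements of `X(K)`. -/
noncomputable def coyonedaObjYonedaIso (K : C) :
    coyoneda.obj (Opposite.op (Ind.yoneda.obj K)) ≅
      Ind.inclusion C ⋙ (evaluation Cᵒᵖ (Type v)).obj (Opposite.op K) :=
  NatIso.ofComponents (fun X => (Ind.inclusion.fullyFaithful.homEquiv.trans
    (((Ind.yonedaCompInclusion.app K).homCongr (Iso.refl _)).trans yonedaEquiv)).toIso)
    (fun {X Y} f => by
      ext g
      change yonedaEquiv ((Ind.yonedaCompInclusion.app K).inv ≫ (Ind.inclusion C).map (g ≫ f) ≫ 𝟙 _) =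
        ((Ind.inclusion C).map f).app _ (yonedaEquiv ((Ind.yonedaCompInclusion.app K).inv ≫
          (Ind.inclusion C).map g ≫ 𝟙 _))
      rw [← yonedaEquiv_comp]
      simp)

/-- Evaluation at `K` preserves filtered colimits of ind-objects, as these are computed in
presheaves. -/
instance (K : C) (I : Type v) [SmallCategory I] [IsFiltered I] :
    PreservesColimitsOfShape I (coyoneda.obj (Opposite.op (Ind.yoneda.obj K))) :=
  preservesColimitsOfShape_of_natIso (coyonedaObjYonedaIso K).symm

variable {I : Type v} [SmallCategory I] [IsFiltered I] {F : I ⥤ C} {c : Cocone (F ⋙ Ind.yoneda)}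

lemma exists_map_comp_ι_eq (hc : IsColimit c) {K : C} (g : Ind.yoneda.obj K ⟶ c.pt) :
    ∃ (i : I) (g₀ : K ⟶ F.obj i), Ind.yoneda.map g₀ ≫ c.ι.app i = g := by
  obtain ⟨i, g, rfl⟩ := exists_hom_of_preservesColimit_coyoneda hc g
  obtain ⟨g, rfl⟩ := Ind.yoneda.map_surjective g
  exact ⟨i, g, rfl⟩

variable [Abelian C]

lemma exists_comp_map_eq_zero (hc : IsColimit c) {K : C} {i : I} (g : K ⟶ F.obj i)
    (h : Ind.yoneda.map g ≫ c.ι.app i = 0) : ∃ (j : I) (f : i ⟶ j), g ≫ F.map f = 0 := by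
  obtain ⟨j, f, hf⟩ := exists_eq_of_preservesColimit_coyoneda_self hc (Ind.yoneda.map g)
    (Ind.yoneda.map 0) (by rw [h, Functor.map_zero, zero_comp])
  refine ⟨j, f, Ind.yoneda.map_injective ?_⟩
  rw [Functor.map_comp, Functor.map_zero]
  simpa using hf

/-- An epimorphism from an ind-object to an object `M` of `C` restricts to an epimorphism from an
object of `C`. -/
lemma exists_epi_comp {X : Ind C} {M : C} (p : X ⟶ Ind.yoneda.obj M) [Epi p] :
    ∃ (Y : C) (f : Ind.yoneda.obj Y ⟶ X), Epi (f ≫ p) := by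
  let G := X.presentation.F
  let a (i) : Ind.yoneda.obj (G.obj i) ⟶ X :=
    colimit.ι (G ⋙ Ind.yoneda) i ≫ X.colimitPresentationCompYoneda.hom
  have ha {i j} (f : i ⟶ j) : Ind.yoneda.map (G.map f) ≫ a j = a i :=
    colimit.w_assoc (G ⋙ Ind.yoneda) f _
  have ha' {Y : Ind C} {f g : X ⟶ Y} (h : ∀ i, a i ≫ f = a i ≫ g) : f = g := by
    rw [← cancel_epi X.colimitPresentationCompYoneda.hom]
    exact colimit.hom_ext fun i => by simpa only [a, Category.assoc] using h i
  choose g hg using fun i => Ind.yoneda.map_surjective (a i ≫ p)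
  have hg' {i j} (f : i ⟶ j) : G.map f ≫ g j = g i :=
    Ind.yoneda.map_injective (by rw [Functor.map_comp, hg, hg, reassoc_of% (ha f)])
  -- It suffices that some stage `g i` of `p` has zero cokernel. These cokernels form a filtered
  -- diagram of quotients of `M`.
  let Q : X.presentation.I ⥤ C :=
    { obj i := cokernel (g i)
      map {i j} f := cokernel.map (g i) (g j) (G.map f) (𝟙 M) (by rw [hg', Category.comp_id]) }
  have hQ {i j} (f : i ⟶ j) : cokernel.π (g i) ≫ Q.map f = cokernel.π (g j) := by simp [Q]
  -- The map from `M` to the colimit of the cokernels does not depend on the stage, and it vanishes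
  -- because its composite with the epimorphism `p` does.
  let q (i) : Ind.yoneda.obj M ⟶ colimit (Q ⋙ Ind.yoneda) :=
    Ind.yoneda.map (cokernel.π (g i)) ≫ colimit.ι (Q ⋙ Ind.yoneda) i
  have hq {i j} (f : i ⟶ j) : q i = q j := by
    dsimp only [q]
    rw [← colimit.w (Q ⋙ Ind.yoneda) f, Functor.comp_map, ← Functor.map_comp_assoc, hQ]
  have hgq (i) : a i ≫ p ≫ q i = 0 := by
    rw [← Category.assoc, ← hg, ← Category.assoc, ← Functor.map_comp, cokernel.condition,
      Functor.map_zero, zero_comp]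
  obtain ⟨i⟩ : Nonempty X.presentation.I := IsFiltered.nonempty
  have hi : q i = 0 := by
    rw [← cancel_epi p, comp_zero]
    refine ha' fun j => ?_
    rw [hq (IsFiltered.leftToMax i j), ← hq (IsFiltered.rightToMax i j), hgq, comp_zero]
  -- By compactness of `M` the projection to the cokernel is already zero at some stage `j`, so `g
  -- j` is an epimorphism.
  obtain ⟨j, f, hf⟩ := exists_comp_map_eq_zero (colimit.isColimit (Q ⋙ Ind.yoneda))
    (cokernel.π (g i)) hi
  have : Epi (g j) := Preadditive.epi_of_cokernel_zero ((hQ f).symm.trans hf)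
  exact ⟨_, a j, by rw [← hg]; infer_instance⟩

end CategoryTheory.Ind

/-! ### The comparison theorems for `Ind C` -/

lemma isExtensionFull_indYoneda (C : Type u) [Category.{v} C] [Abelian C] :
    IsExtensionFull (Ind.yoneda : C ⥤ Ind C) := by
  intro M N n
  -- The object `N` is viewed as a constant diagram on the one-point category, with identity
  -- structure maps; the factorization condition is then fullness.
  have h {K : C} (g : Ind.yoneda.obj K ⟶ Ind.yoneda.obj N) :
      ∃ (_ : Discrete PUnit.{1}) (g₀ : K ⟶ N), Ind.yoneda.map g₀ ≫ 𝟙 _ = g :=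
    ⟨⟨⟨⟩⟩, _, (Category.comp_id _).trans (Ind.yoneda.map_preimage g)⟩
  constructor
  · rw [injective_iff_map_eq_zero]
    intro x hx
    obtain ⟨j, f, hf⟩ := YExt.exists_push_eq_zero Ind.yoneda ((Functor.const (Discrete PUnit.{1})).obj N)
      (fun _ => 𝟙 (Ind.yoneda.obj N)) (fun f => by simp) Ind.exists_epi_comp h
      (fun {K i} g hg => ⟨i, 𝟙 i, Ind.yoneda.map_injective (by simpa using hg)⟩) n M ⟨⟨⟩⟩ x
      (by simp [hx])
    simpa [YExt.push_id] using hf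
  · intro x
    obtain ⟨i, y, hy⟩ := YExt.exists_push_map Ind.yoneda ((Functor.const (Discrete PUnit.{1})).obj N)
      (fun _ => 𝟙 (Ind.yoneda.obj N)) Ind.exists_epi_comp h n M x
    exact ⟨y, by simpa [YExt.push_id] using hy⟩

lemma isIso_desc_extCocone {C : Type u} [Category.{v} C] [Abelian C]
    {I : Type v} [SmallCategory I] [IsFiltered I] (F : I ⥤ C) (c : Cocone (F ⋙ Ind.yoneda))
    (hc : IsColimit c) (Z : C) (n : ℕ) : IsIso (colimit.desc _ (extCocone F c Z n)) := by
  -- Filtered colimits of abelian groups are formed on underlying sets, so every element of the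
  -- colimit comes from one stage.
  have : PreservesFilteredColimitsOfSize.{v, v} (forget AddCommGrpCat.{max u (v + 1)}) :=
    preservesFilteredColimitsOfSize_shrink.{v, max u (v + 1), v, max u (v + 1)} _
  let H := F ⋙ YExt.functor Z n ⋙ AddCommGrpCat.uliftFunctor.{v + 1, max u v}
  have hdesc (i : I) (x : H.obj i) : colimit.desc H (extCocone F c Z n) (colimit.ι H i x) =
      (extCocone F c Z n).ι.app i x :=
    ConcreteCategory.congr_hom (colimit.ι_desc (extCocone F c Z n) i) x
  have : Mono (colimit.desc H (extCocone F c Z n)) := by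
    rw [AddCommGrpCat.mono_iff_injective, injective_iff_map_eq_zero]
    intro x hx
    obtain ⟨i, x, rfl⟩ := Concrete.colimit_exists_rep H x
    rw [hdesc] at hx
    obtain ⟨j, f, hf⟩ := YExt.exists_push_eq_zero Ind.yoneda F (fun i => c.ι.app i)
      (fun f => c.w f) Ind.exists_epi_comp (Ind.exists_map_comp_ι_eq hc)
      (Ind.exists_comp_map_eq_zero hc) n Z i (ULift.down x) hx
    have hf' : H.map f x = 0 := congrArg ULift.up hf
    rw [← ConcreteCategory.congr_hom (colimit.w H f) x, ConcreteCategory.comp_apply, hf',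
      _root_.map_zero]
  have : Epi (colimit.desc H (extCocone F c Z n)) := by
    rw [AddCommGrpCat.epi_iff_surjective]
    intro x
    obtain ⟨i, y, hy⟩ := YExt.exists_push_map Ind.yoneda F (fun i => c.ι.app i)
      Ind.exists_epi_comp (Ind.exists_map_comp_ι_eq hc) n Z x
    exact ⟨colimit.ι H i (ULift.up y), (hdesc i _).trans hy⟩
  exact isIso_of_mono_of_epi _

/-! ### Reversal of exact sequences, and `Pro C` by duality -/

namespace YonedaExt

variable {C : Type u} [Category.{v} C] [Abelian C]

namespace LongExt

/-- The splice of a short exact sequence `0 ⟶ N ⟶ E ⟶ K ⟶ 0` and an exact sequence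
`0 ⟶ K ⟶ X¹ ⟶ ⋯ ⟶ Xᵈ⁺¹ ⟶ M ⟶ 0`. -/
def cons {N K : C} (E : ShortExt K N) : ∀ {d : ℕ} {M : C}, LongExt K d M → LongExt N (d + 1) M
  | _, _, single E' => splice (single E) E'
  | _, _, splice X E' => splice (cons E X) E'

lemma HasMap.cons {N N' K K' : C} {E : ShortExt K N} {E' : ShortExt K' N'} {f : N ⟶ N'}
    {k : K ⟶ K'} (hE : E.HasMap f k E') : ∀ {d : ℕ} {M M' : C} {g : M ⟶ M'} {X : LongExt K d M}
      {Y : LongExt K' d M'}, HasMap k g X Y → HasMap f g (cons E X) (cons E' Y)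
  | _, _, _, _, single _, single _, h => ⟨k, hE, h⟩
  | _, _, _, _, splice _ _, splice _ _, h => by
    obtain ⟨l, h₁, h₂⟩ := h
    exact ⟨l, HasMap.cons hE h₁, h₂⟩

end LongExt

variable {D : Type u'} [Category.{v'} D] [Abelian D]
  (T : Cᵒᵖ ⥤ D) [T.Additive] [PreservesFiniteLimits T] [PreservesFiniteColimits T]

/-- The image of a short exact sequence under a contravariant exact functor. -/
def ShortExt.mapOp {M N : C} (X : ShortExt M N) :
    ShortExt (T.obj (Opposite.op N)) (T.obj (Opposite.op M)) where
  E := T.obj (Opposite.op X.E)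
  i := T.map X.p.op
  p := T.map X.i.op
  zero := by rw [← T.map_comp, ← op_comp, X.zero, op_zero, T.map_zero]
  exact := X.exact.op.map_of_exact T

lemma ShortExt.HasMap.mapOp {M N M' N' : C} {f : N ⟶ N'} {g : M ⟶ M'} {X : ShortExt M N}
    {Y : ShortExt M' N'} (h : X.HasMap f g Y) :
    (Y.mapOp T).HasMap (T.map g.op) (T.map f.op) (X.mapOp T) := by
  obtain ⟨e, h₁, h₂⟩ := h
  exact ⟨T.map e.op,
    by dsimp only [ShortExt.mapOp]; rw [← T.map_comp, ← op_comp, h₂, op_comp, T.map_comp],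
    by dsimp only [ShortExt.mapOp]; rw [← T.map_comp, ← op_comp, h₁, op_comp, T.map_comp]⟩

namespace LongExt

/-- The image of an exact sequence under a contravariant exact functor. -/
def mapOp {N : C} : ∀ {d : ℕ} {M : C}, LongExt N d M →
    LongExt (T.obj (Opposite.op M)) d (T.obj (Opposite.op N))
  | _, _, single E => single (E.mapOp T)
  | _, _, splice X E => cons (E.mapOp T) (mapOp X)

lemma HasMap.mapOp {N N' : C} {f : N ⟶ N'} : ∀ {d : ℕ} {M M' : C} {g : M ⟶ M'} {X : LongExt N d M}
    {Y : LongExt N' d M'}, HasMap f g X Y →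
      HasMap (T.map g.op) (T.map f.op) (Y.mapOp T) (X.mapOp T)
  | _, _, _, _, single _, single _, h => ShortExt.HasMap.mapOp T h
  | _, _, _, _, splice _ _, splice _ _, h => by
    obtain ⟨k, h₁, h₂⟩ := h
    exact HasMap.cons (h₂.mapOp T) (HasMap.mapOp h₁)

/-- Reversal exchanges splicing at the left end with splicing at the right end; this is needed to
see that reversing twice gives back the sequence. -/
lemma mapOp_cons {N K : C} (E : ShortExt K N) : ∀ {d : ℕ} {M : C} (X : LongExt K d M),
    mapOp T (cons E X) = splice (mapOp T X) (E.mapOp T)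
  | _, _, single _ => rfl
  | _, _, splice X E' => congrArg (cons (E'.mapOp T)) (mapOp_cons E X)

lemma map_cons (F : C ⥤ D) [F.Additive] [PreservesFiniteLimits F] [PreservesFiniteColimits F]
    {N K : C} (E : ShortExt K N) : ∀ {d : ℕ} {M : C} (X : LongExt K d M),
    map F (cons E X) = cons (E.map F) (map F X)
  | _, _, single _ => rfl
  | _, _, splice X E' => congrArg (splice · (E'.map F)) (map_cons F E X)

end LongExt

/-- The map induced on classes by a contravariant exact functor. -/
def ExtClass.mapOp {M N : C} {d : ℕ} : ExtClass M N d →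
    ExtClass (T.obj (Opposite.op N)) (T.obj (Opposite.op M)) d :=
  Quot.lift (fun X => mk (X.mapOp T)) (by
    rintro X Y ⟨Z, h, h'⟩
    exact (sound (by simpa using h.mapOp T)).trans (sound (by simpa using h'.mapOp T)).symm)

end YonedaExt

namespace YExt

variable {C : Type u} [Category.{v} C] [Abelian C] {D : Type u'} [Category.{v'} D] [Abelian D]

section

variable (T : Cᵒᵖ ⥤ D) [T.Additive] [PreservesFiniteLimits T] [PreservesFiniteColimits T]

/-- The map `Extⁿ(M, N) ⟶ Extⁿ(T N, T M)` induced by a contravariant exact functor `T`. -/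
def mapOp {M N : C} : ∀ {n : ℕ}, YExt M N n →
    YExt (T.obj (Opposite.op N)) (T.obj (Opposite.op M)) n
  | 0, x => ULift.up (T.map x.down.op)
  | _ + 1, x => ExtClass.mapOp T x

end

instance : (unopUnop C).Additive where

lemma mapOp_unopUnop_mapOp_id {M N : C} {n : ℕ} (x : YExt M N n) :
    mapOp (unopUnop C) (mapOp (𝟭 Cᵒᵖ) x) = x := by
  cases n with
  | zero => rfl
  | succ d =>
    obtain ⟨X, rfl⟩ := Quot.exists_rep (r := Rel (N := N) (M := M) (d := d)) x
    refine congrArg ExtClass.mk ?_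
    induction X with
    | single E => rfl
    | splice X E ih =>
      exact (LongExt.mapOp_cons _ _ _).trans (congrArg (LongExt.splice · E) ih)

lemma mapOp_id_mapOp_unopUnop {M N : Cᵒᵖ} {n : ℕ} (x : YExt M N n) :
    mapOp (𝟭 Cᵒᵖ) (mapOp (unopUnop C) x) = x := by
  cases n with
  | zero => rfl
  | succ d =>
    obtain ⟨X, rfl⟩ := Quot.exists_rep (r := Rel (N := N) (M := M) (d := d)) x
    refine congrArg ExtClass.mk ?_
    induction X with
    | single E => rfl
    | splice X E ih =>
      exact (LongExt.mapOp_cons _ _ _).trans (congrArg (LongExt.splice · E) ih)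

/-- Applying `G.rightOp` and then reversing is the same as reversing and then applying `G`, already
for sequences and not only for classes. -/
lemma mapOp_unopUnop_map_rightOp (G : Cᵒᵖ ⥤ D) [G.Additive] [PreservesFiniteLimits G]
    [PreservesFiniteColimits G] [PreservesFiniteLimits G.rightOp]
    [PreservesFiniteColimits G.rightOp] {M N : C} {n : ℕ} (x : YExt M N n) :
    mapOp (unopUnop D) (map G.rightOp M N n x) =
      map G (Opposite.op N) (Opposite.op M) n (mapOp (𝟭 Cᵒᵖ) x) := by
  cases n with
  | zero => rfl
  | succ d =>
    obtain ⟨X, rfl⟩ := Quot.exists_rep (r := Rel (N := N) (M := M) (d := d)) x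
    refine congrArg ExtClass.mk ?_
    induction X with
    | single E => rfl
    | splice X E ih =>
      exact .trans (congrArg (LongExt.cons _) ih)
        (LongExt.map_cons G (E.mapOp (𝟭 Cᵒᵖ)) (X.mapOp (𝟭 Cᵒᵖ))).symm

end YExt

/-- The reversal maps are bijections between the Ext sets of a category and of its opposite, and
they intertwine the maps induced by `G.rightOp` and `G`. -/
lemma isExtensionFull_rightOp {C : Type u} [Category.{v} C] [Abelian C] {D : Type u'}
    [Category.{v'} D] [Abelian D] (G : Cᵒᵖ ⥤ D) [G.Full] [G.Faithful] [G.Additive]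
    [PreservesFiniteLimits G] [PreservesFiniteColimits G] [PreservesFiniteLimits G.rightOp]
    [PreservesFiniteColimits G.rightOp] (hG : IsExtensionFull G) : IsExtensionFull G.rightOp := by
  intro M N n
  obtain ⟨hi, hs⟩ := hG (Opposite.op N) (Opposite.op M) n
  constructor
  · intro x y h
    have h' : YExt.mapOp (𝟭 Cᵒᵖ) x = YExt.mapOp (𝟭 Cᵒᵖ) y := hi (by
      rw [← YExt.mapOp_unopUnop_map_rightOp, ← YExt.mapOp_unopUnop_map_rightOp, h])
    rw [← YExt.mapOp_unopUnop_mapOp_id x, h', YExt.mapOp_unopUnop_mapOp_id y]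
  · intro y
    obtain ⟨z, hz⟩ := hs (YExt.mapOp (unopUnop D) y)
    refine ⟨YExt.mapOp (unopUnop C) z, ?_⟩
    refine (Function.LeftInverse.injective (g := YExt.mapOp (𝟭 Dᵒᵖ))
      YExt.mapOp_id_mapOp_unopUnop) ?_
    rw [YExt.mapOp_unopUnop_map_rightOp, YExt.mapOp_id_mapOp_unopUnop, hz]

theorem mainTheorem3 {C : Type u} [Category.{v} C] [Abelian C] :
    (IsExtensionFull (Ind.yoneda : C ⥤ Ind C) ∧ IsExtensionFull (Pro.embedding : C ⥤ Pro C)) ∧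
    ∀ (I : Type v) [SmallCategory I] [IsFiltered I] (F : I ⥤ C) (c : Cocone (F ⋙ Ind.yoneda))
      (_ : IsColimit c) (Z : C) (n : ℕ), IsIso (colimit.desc _ (extCocone F c Z n)) :=
  ⟨⟨isExtensionFull_indYoneda C, isExtensionFull_rightOp _ (isExtensionFull_indYoneda Cᵒᵖ)⟩,
    fun _ _ _ F c hc Z n => isIso_desc_extCocone F c hc Z n⟩
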